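/- All graphs are finite and simple. For a graph $H$ let $\delta(H)$ and $\Delta(H)$ be its minimum and maximum degree. For a fixed graph $H$, the parameterized problem $H$-free Edge Deletion is: given a graph $G$ and $k \in \mathbb{N}$ (the parameter), can one delete at most $k$ edges from $G$ so that the remaining graph has no induced subgraph isomorphic to $H$? A linear parameterized reduction from a parameterized problem $A$ to a parameterized problem $B$ is a polynomial-time computable map $(G,k) \mapsto (G',k')$ on instances such that $(G,k)$ is a yes-instance of $A$ if and only if $(G',k')$ is a yes-instance of $B$, and $k' \le C k$ for a constant $C$ that does not depend on the instance; here the size of an instance $(G,k)$ is $|V(G)| + |E(G)| + k$. For integers $h > \ell \geq 0$, a sparse $(\ell,h)$-degree graph is a graph in which every vertex has degree $\ell$ or $h$, the vertices of degree $\ell$ induce a graph with at most one edge, and the vertices of degree $h$ induce a graph with at most one edge. The procedure Deletion-Churn takes a graph $H$ with at least two edges and runs as follows. Step 1: If the vertices of degree more than $\delta(H)$ induce a subgraph with at most one edge and the vertices of degree less than $\Delta(H)$ induce a subgraph with at most one edge, return $H$. Step 2: If the vertices of degree more than $\delta(H)$ induce a subgraph with at least two edges, delete all vertices of degree $\delta(H)$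 from $H$ and go to Step 1. Step 3: If the vertices of degree less than $\Delta(H)$ induce a subgraph with at least two edges, delete all vertices of degree $\Delta(H)$ from $H$ and go to Step 1. Lemma. Let $H$ be a graph with at least two edges. Then Deletion-Churn($H$) terminates and returns a graph $H'$ (an induced subgraph of $H$) such that: (i) there is a linear parameterized reduction from $H'$-free Edge Deletion to $H$-free Edge Deletion; (ii) $H'$ has at least two edges, and $H'$ is a regular graph, or a forest, or a sparse $(\ell,h)$-degree graph for some $h > \ell \geq 0$. -/

import Mathlib

universe u

section Churn

variable {V : Type u} [Fintype V]

/-- The number of edges of a finite graph. -/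
noncomputable def numEdges (G : SimpleGraph V) : ℕ := G.edgeSet.ncard

open Classical in
/-- The vertices of degree more than the minimum degree `δ(G)`. -/
noncomputable def aboveMinDegree (G : SimpleGraph V) : Finset V :=
  Finset.univ.filter fun v => G.minDegree < G.degree v

open Classical in
/-- The vertices of degree less than the maximum degree `Δ(G)`. -/
noncomputable def belowMaxDegree (G : SimpleGraph V) : Finset V :=
  Finset.univ.filter fun v => G.degree v < G.maxDegree

open Classical in
/-- A graph is regular if all of its vertices have the same degree. -/
def IsRegularGraph (G : SimpleGraph V) : Prop := ∃ d : ℕ, G.IsRegularOfDegree d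

open Classical in
/-- The set of vertices of degree `d`. -/
noncomputable def verticesOfDegree (G : SimpleGraph V) (d : ℕ) : Finset V :=
  Finset.univ.filter fun v => G.degree v = d

/-- A sparse `(ℓ, h)`-degree graph: `ℓ < h`, every vertex has degree `ℓ` or `h`, and the vertices
of degree `ℓ`, as well as those of degree `h`, induce a graph with at most one edge. -/
def IsSparseDegreeGraph (G : SimpleGraph V) (l h : ℕ) : Prop :=
  l < h ∧ (∀ v, v ∈ verticesOfDegree G l ∨ v ∈ verticesOfDegree G h) ∧
    numEdges (G.induce (verticesOfDegree G l : Set V)) ≤ 1 ∧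
    numEdges (G.induce (verticesOfDegree G h : Set V)) ≤ 1

theorem nonempty_of_numEdges {S : Finset V} {G : SimpleGraph V}
    (h : 2 ≤ numEdges (G.induce (S : Set V))) : Nonempty V := by
  by_contra hV
  rw [not_nonempty_iff] at hV
  have : numEdges (G.induce (S : Set V)) = 0 := by
    unfold numEdges
    rw [Set.ncard_eq_zero]
    ext e
    induction e with
    | _ a b => exact hV.elim a.1
  omega

theorem card_coe_lt {S : Finset V} {v : V} (hv : v ∉ S) :
    Fintype.card (S : Set V) < Fintype.card V := by
  exact Fintype.card_subtype_lt (x := v) (by simpa using hv)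

theorem card_aboveMinDegree_lt (G : SimpleGraph V)
    (h : 2 ≤ numEdges (G.induce (aboveMinDegree G : Set V))) :
    Fintype.card (aboveMinDegree G : Set V) < Fintype.card V := by
  classical
  have := nonempty_of_numEdges h
  obtain ⟨v, hv⟩ := G.exists_minimal_degree_vertex
  refine card_coe_lt (v := v) ?_
  simp only [aboveMinDegree, Finset.mem_filter, Finset.mem_univ, true_and, not_lt]
  convert hv.ge

theorem card_belowMaxDegree_lt (G : SimpleGraph V)
    (h : 2 ≤ numEdges (G.induce (belowMaxDegree G : Set V))) :
    Fintype.card (belowMaxDegree G : Set V) < Fintype.card V := by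
  classical
  have := nonempty_of_numEdges h
  obtain ⟨v, hv⟩ := G.exists_maximal_degree_vertex
  refine card_coe_lt (v := v) ?_
  simp only [belowMaxDegree, Finset.mem_filter, Finset.mem_univ, true_and, not_lt]
  convert hv.le

end Churn

/-- The procedure Deletion-Churn. It returns the set of the vertices of `H` that are never deleted;
the graph that it returns is the subgraph of `H` induced by this set.

Step 1: if the vertices of degree more than `δ(H)` induce at most one edge and so do the vertices
of degree less than `Δ(H)`, return `H`.
Step 2: if the vertices of degree more than `δ(H)` induce at least two edges, delete the vertices
of degree `δ(H)` and start again.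
Step 3: otherwise the vertices of degree less than `Δ(H)` induce at least two edges; delete the
vertices of degree `Δ(H)` and start again. -/
noncomputable def deletionChurn {V : Type u} [Fintype V] (H : SimpleGraph V) : Finset V :=
  open Classical in
  if _h₁ : numEdges (H.induce (aboveMinDegree H : Set V)) ≤ 1 ∧
      numEdges (H.induce (belowMaxDegree H : Set V)) ≤ 1 then
    Finset.univ
  else if h₂ : 2 ≤ numEdges (H.induce (aboveMinDegree H : Set V)) then
    (deletionChurn (H.induce (aboveMinDegree H : Set V))).map (Function.Embedding.subtype _)
  else
    (deletionChurn (H.induce (belowMaxDegree H : Set V))).map (Function.Embedding.subtype _)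
termination_by Fintype.card V
decreasing_by
  · exact card_aboveMinDegree_lt H h₂
  · refine card_belowMaxDegree_lt H ?_
    omega

/-- An instance `(G, k)` of a parameterized graph problem: a finite graph and the parameter. -/
structure GraphInstance where
  /-- number of vertices -/
  n : ℕ
  /-- the graph -/
  graph : SimpleGraph (Fin n)
  /-- the parameter -/
  k : ℕ

open Classical in
/-- The binary encoding `1ᵏ 0 1ⁿ 0 A` of an instance, where `A` lists the entries of the adjacency
matrix row by row. Its length is polynomially related to `|G| + k`: as usual for parameterized
problems the parameter counts with its value. -/
noncomputable def GraphInstance.encode (I : GraphInstance) : List Bool :=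
  List.replicate I.k true ++ false :: (List.replicate I.n true ++ false ::
    (List.finRange I.n).flatMap fun i =>
      (List.finRange I.n).map fun j => decide (I.graph.Adj i j))

/-- The yes-instances of `H`-free Edge Deletion: `(G, k)` such that one can delete at most `k` edges
from `G` so that no induced subgraph of the remaining graph is isomorphic to `H`. -/
def freeEdgeDeletion {V : Type u} (H : SimpleGraph V) : Set GraphInstance :=
  {I | ∃ F : Finset (Sym2 (Fin I.n)), (F : Set (Sym2 (Fin I.n))) ⊆ I.graph.edgeSet ∧
    F.card ≤ I.k ∧ ¬ H.IsIndContained (I.graph.deleteEdges (F : Set (Sym2 (Fin I.n))))}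

/-- There is a linear parameterized reduction from `A` to `B`: a map on instances that a Turing
machine computes in polynomial time, that preserves and reflects yes-instances, and
whose output parameter is at most a constant times the input parameter. -/
def LinearParamReducible (A B : Set GraphInstance) : Prop :=
  ∃ f : GraphInstance → GraphInstance,
    Nonempty (Turing.TM2ComputableInPolyTime GraphInstance.encode GraphInstance.encode f) ∧
    (∀ I, I ∈ A ↔ f I ∈ B) ∧
    ∃ C : ℕ, ∀ I, (f I).k ≤ C * I.k

/-! Structure of the output. When the procedure stops, the vertices above the minimum degree δ and
those below the maximum degree Δ each span at most one edge. If δ ≤ 1, all vertices of a cycle have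
degree above δ, so there is no cycle. Suppose δ ≥ 2 and the graph is not regular. Then every vertex
lies in at least one of the two classes. A vertex of intermediate degree lies in both and has at
least three neighbours, two of which share a class, and this class then spans two edges. So only the
degrees δ and Δ occur (`isChurned_of_numEdges_le_one`). The branch conditions keep at least two
edges throughout.

Reduction. The whole run is treated at once, so that no reductions have to be composed. Surviving
vertices get level 0, deleted ones a positive level, higher if deleted earlier. The bit of a level
is a default adjacency: `false` if minimum-degree vertices were deleted, `true` for maximum degree.
In both cases the deleted vertices deviate from the default less often than every vertex kept
(`IsPeeling`, `exists_isPeeling_deletionChurn`).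

The new graph consists of G and, for every map g from V(H) to V(G) and each of k + 1 tags, a copy of
the vertices of positive level. A copy is joined as in H within itself and to the vertices where g
places level 0. All other pairs with a new vertex follow the default of the higher level. The
parameter stays k.

If k edges destroy every induced H in the new graph, they destroy every induced H' in G: the k + 1
copies over a surviving H' would each need their own deleted edge
(`not_isIndContained_of_not_isIndContained`). Conversely, let a solution for G leave an induced H in
the new graph. Comparing numbers of deviations shows, from the top level down, that no vertex of H
is mapped to a higher level, so level 0 is mapped into G and gives an induced H' there
(`isIndContained_of_isIndContained_deleteEdges`).

Computability. As H is fixed, nested loops over a fixed number of counters write the new instance. A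
small language of such loops is compiled to stack machines with polynomial time bounds. -/

/-! ### A small structured language for multi-stack machines -/

/-- Structured programs acting on stacks of Booleans indexed by `K`. -/
inductive Prog (K : Type) : Type
  | skip : Prog K
  | push (k : K) (b : Bool) : Prog K
  | seq (p q : Prog K) : Prog K
  /-- pop `k` and branch on the result: empty, `true` or `false` -/
  | popCase (k : K) (pn pt pf : Prog K) : Prog K
  /-- pop `k`; if the result is `true`, run `p` and repeat, otherwise leave the loop -/
  | loop (k : K) (p : Prog K) : Prog K

namespace Prog

open Turing

variable {K : Type}

/-- The program labels of the compiled program. -/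
def Lab : Prog K → Type
  | skip => Unit
  | push _ _ => Unit
  | seq p q => Lab p ⊕ Lab q
  | popCase _ pn pt pf => Option (Lab pn ⊕ (Lab pt ⊕ Lab pf))
  | loop _ p => Option (Lab p)

/-- The label sets are finite. -/
@[reducible]
noncomputable def labFintype : (p : Prog K) → Fintype (Lab p)
  | skip => inferInstanceAs (Fintype Unit)
  | push _ _ => inferInstanceAs (Fintype Unit)
  | seq p q =>
    letI := labFintype p
    letI := labFintype q
    inferInstanceAs (Fintype (Lab p ⊕ Lab q))
  | popCase _ pn pt pf =>
    letI := labFintype pn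
    letI := labFintype pt
    letI := labFintype pf
    inferInstanceAs (Fintype (Option (Lab pn ⊕ (Lab pt ⊕ Lab pf))))
  | loop _ p =>
    letI := labFintype p
    inferInstanceAs (Fintype (Option (Lab p)))

/-- The label at which a program starts. -/
def entry : (p : Prog K) → Lab p
  | skip => ()
  | push _ _ => ()
  | seq p _ => Sum.inl (entry p)
  | popCase _ _ _ _ => none
  | loop _ _ => none

/-- The machine code of a program whose labels are embedded in `L` by `emb` and which continues
at the label `exit`. -/
def code {L : Type} : (p : Prog K) → (Lab p → L) → L → Lab p →
    TM2.Stmt (fun _ : K => Bool) L (Option Bool)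
  | skip, _, exit, _ => .goto fun _ => exit
  | push k b, _, exit, _ => .push k (fun _ => b) (.goto fun _ => exit)
  | seq p q, emb, exit, l =>
    match l with
    | Sum.inl l => code p (fun x => emb (Sum.inl x)) (emb (Sum.inr (entry q))) l
    | Sum.inr l => code q (fun x => emb (Sum.inr x)) exit l
  | popCase k pn pt pf, emb, exit, l =>
    match l with
    | none => .pop k (fun _ o => o) (.goto fun o =>
        match o with
        | none => emb (some (Sum.inl (entry pn)))
        | some true => emb (some (Sum.inr (Sum.inl (entry pt))))
        | some false => emb (some (Sum.inr (Sum.inr (entry pf)))))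
    | some (Sum.inl l) => code pn (fun x => emb (some (Sum.inl x))) exit l
    | some (Sum.inr (Sum.inl l)) => code pt (fun x => emb (some (Sum.inr (Sum.inl x)))) exit l
    | some (Sum.inr (Sum.inr l)) => code pf (fun x => emb (some (Sum.inr (Sum.inr x)))) exit l
  | loop k p, emb, exit, l =>
    match l with
    | none => .pop k (fun _ o => o) (.goto fun o =>
        match o with
        | some true => emb (some (entry p))
        | _ => exit)
    | some l => code p (fun x => emb (some x)) (emb none) l

variable [DecidableEq K]

/-- Big-step semantics: `Run p s s' t` says that `p` turns `s` into `s'` in `t` steps. -/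
inductive Run : Prog K → (K → List Bool) → (K → List Bool) → ℕ → Prop
  | skip (s) : Run skip s s 1
  | push (k b s) : Run (push k b) s (Function.update s k (b :: s k)) 1
  | seq {p q s s₁ s₂ t₁ t₂} (h₁ : Run p s s₁ t₁) (h₂ : Run q s₁ s₂ t₂) :
      Run (seq p q) s s₂ (t₂ + t₁)
  | popNil {k pn pt pf s s' t} (hk : s k = []) (h : Run pn s s' t) :
      Run (popCase k pn pt pf) s s' (t + 1)
  | popTrue {k pn pt pf s s' t l} (hk : s k = true :: l)
      (h : Run pt (Function.update s k l) s' t) : Run (popCase k pn pt pf) s s' (t + 1)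
  | popFalse {k pn pt pf s s' t l} (hk : s k = false :: l)
      (h : Run pf (Function.update s k l) s' t) : Run (popCase k pn pt pf) s s' (t + 1)
  | loopNil {k p s} (hk : s k = []) : Run (loop k p) s s 1
  | loopFalse {k p s l} (hk : s k = false :: l) : Run (loop k p) s (Function.update s k l) 1
  | loopTrue {k p s s₁ s₂ t₁ t₂ l} (hk : s k = true :: l)
      (h₁ : Run p (Function.update s k l) s₁ t₁) (h₂ : Run (loop k p) s₁ s₂ t₂) :
      Run (loop k p) s s₂ (t₂ + t₁ + 1)

theorem iterate_step {L : Type} (M : L → TM2.Stmt (fun _ : K => Bool) L (Option Bool))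
    (t : ℕ) (l : L) (v : Option Bool) (s : K → List Bool) :
    (flip bind (TM2.step M))^[t + 1] (some ⟨some l, v, s⟩) =
      (flip bind (TM2.step M))^[t] (some (TM2.stepAux (M l) v s)) := rfl

/-- The compiled program simulates the big-step semantics step by step. -/
theorem Run.simulate {L : Type} (M : L → TM2.Stmt (fun _ : K => Bool) L (Option Bool))
    {p : Prog K} {s s' : K → List Bool} {t : ℕ} (h : Run p s s' t) :
    ∀ (emb : Lab p → L) (exit : L), (∀ l, M (emb l) = code p emb exit l) →
      ∀ v, ∃ v', (flip bind (TM2.step M))^[t] (some ⟨some (emb (entry p)), v, s⟩) =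
        some ⟨some exit, v', s'⟩ := by
  induction h with
  | skip s =>
    intro emb exit hM v
    refine ⟨v, ?_⟩
    rw [iterate_step, hM]
    rfl
  | push k b s =>
    intro emb exit hM v
    refine ⟨v, ?_⟩
    rw [iterate_step, hM]
    rfl
  | @seq p q _ _ _ t₁ t₂ _ _ ih₁ ih₂ =>
    intro emb exit hM v
    obtain ⟨v₁, h₁⟩ := ih₁ (fun x => emb (Sum.inl x)) (emb (Sum.inr (entry q)))
      (fun l => hM (Sum.inl l)) v
    obtain ⟨v₂, h₂⟩ := ih₂ (fun x => emb (Sum.inr x)) exit (fun l => hM (Sum.inr l)) v₁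
    exact ⟨v₂, by rw [Function.iterate_add_apply]; erw [h₁]; exact h₂⟩
  | popNil hk _ ih =>
    intro emb exit hM v
    obtain ⟨v₁, h₁⟩ := ih (fun x => emb (some (Sum.inl x))) exit
      (fun l => hM (some (Sum.inl l))) none
    refine ⟨v₁, ?_⟩
    rw [iterate_step, hM, ← h₁]
    simp only [entry, code, TM2.stepAux, hk, List.head?, List.tail]
    congr 3
    rw [← hk, Function.update_eq_self]
  | popTrue hk _ ih =>
    intro emb exit hM v
    obtain ⟨v₁, h₁⟩ := ih (fun x => emb (some (Sum.inr (Sum.inl x)))) exit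
      (fun l => hM (some (Sum.inr (Sum.inl l)))) (some true)
    refine ⟨v₁, ?_⟩
    rw [iterate_step, hM, ← h₁]
    simp only [entry, code, TM2.stepAux, hk, List.head?, List.tail]
  | popFalse hk _ ih =>
    intro emb exit hM v
    obtain ⟨v₁, h₁⟩ := ih (fun x => emb (some (Sum.inr (Sum.inr x)))) exit
      (fun l => hM (some (Sum.inr (Sum.inr l)))) (some false)
    refine ⟨v₁, ?_⟩
    rw [iterate_step, hM, ← h₁]
    simp only [entry, code, TM2.stepAux, hk, List.head?, List.tail]
  | loopNil hk =>
    intro emb exit hM v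
    refine ⟨none, ?_⟩
    rw [iterate_step, hM]
    simp only [entry, code, TM2.stepAux, hk, List.head?, List.tail, Function.iterate_zero, id]
    congr 2
    rw [← hk, Function.update_eq_self]
  | loopFalse hk =>
    intro emb exit hM v
    refine ⟨some false, ?_⟩
    rw [iterate_step, hM]
    simp only [entry, code, TM2.stepAux, hk, List.head?, List.tail, Function.iterate_zero, id]
  | loopTrue hk _ _ ih₁ ih₂ =>
    intro emb exit hM v
    obtain ⟨v₁, h₁⟩ := ih₁ (fun x => emb (some x)) (emb none) (fun l => hM (some l)) (some true)
    obtain ⟨v₂, h₂⟩ := ih₂ emb exit hM v₁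
    refine ⟨v₂, ?_⟩
    rw [iterate_step, hM, Function.iterate_add_apply, ← h₂]
    congr 1
    refine Eq.trans ?_ h₁
    simp only [entry, code, TM2.stepAux, hk, List.head?, List.tail]

/-- `RunIn p s s' T`: the program `p` turns `s` into `s'` in at most `T` steps. -/
def RunIn (p : Prog K) (s s' : K → List Bool) (T : ℕ) : Prop := ∃ t ≤ T, Run p s s' t

variable [Fintype K]

/-- The machine that runs a program and halts. -/
noncomputable def toFinTM2 (p : Prog K) (k₀ k₁ : K) : FinTM2 where
  K := K
  kDecidableEq := inferInstance
  kFin := inferInstance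
  k₀ := k₀
  k₁ := k₁
  Γ := fun _ => Bool
  Λ := Option (Lab p)
  main := some (entry p)
  ΛFin := letI := labFintype p; inferInstance
  σ := Option Bool
  initialState := none
  σFin := inferInstance
  Γk₀Fin := inferInstanceAs (Fintype Bool)
  m := fun l => match l with
    | none => .load (fun _ => none) .halt
    | some l => code p some none l

/-- Initial and halting configurations of a stack machine describe the stacks by a case distinction
with a transport along an equality; this turns them into updates of the empty memory. -/
theorem dite_eq_update {K : Type} [DecidableEq K] (k₀ k : K) (x : List Bool)
    (f : k = k₀ → List Bool) (hf : ∀ h, f h = x) :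
    (if h : k = k₀ then f h else []) = Function.update (fun _ => []) k₀ x k := by
  by_cases h : k = k₀
  · subst h
    simp [hf]
  · simp [h]

/-- A program that computes `f` in polynomial time yields a Turing machine that does. -/
theorem nonempty_tm2ComputableInPolyTime {α β : Type} {ea : α → List Bool} {eb : β → List Bool}
    {f : α → β} (p : Prog K) (k₀ k₁ : K) (T : Polynomial ℕ)
    (h : ∀ a, RunIn p (Function.update (fun _ => []) k₀ (ea a))
      (Function.update (fun _ => []) k₁ (eb (f a))) (T.eval (ea a).length)) :
    Nonempty (TM2ComputableInPolyTime ea eb f) := by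
  refine ⟨⟨⟨toFinTM2 p k₀ k₁, Equiv.refl Bool, Equiv.refl Bool⟩, T + 1, fun a => ?_⟩⟩
  have key : ∃ t ≤ (T + 1).eval (ea a).length,
      (flip bind (toFinTM2 p k₀ k₁).step)^[t] (some (initList (toFinTM2 p k₀ k₁)
        (List.map (Equiv.refl Bool).invFun (ea a)))) =
        some (haltList (toFinTM2 p k₀ k₁) (List.map (Equiv.refl Bool).invFun (eb (f a)))) := by
    obtain ⟨t, ht, hr⟩ := h a
    obtain ⟨v', hv⟩ := hr.simulate (toFinTM2 p k₀ k₁).m some none (fun _ => rfl) none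
    -- The additional step executes the halting statement at the label `none`.
    refine ⟨1 + t, by simp; omega, ?_⟩
    have h₀ : initList (toFinTM2 p k₀ k₁) (List.map (Equiv.refl Bool).invFun (ea a)) =
        ⟨some (some (entry p)), none, Function.update (fun _ => []) k₀ (ea a)⟩ := by
      unfold initList
      congr 1
      funext k
      exact dite_eq_update k₀ k (ea a) _ (fun _ => List.map_id _)
    have h₁ : haltList (toFinTM2 p k₀ k₁) (List.map (Equiv.refl Bool).invFun (eb (f a))) =
        ⟨none, none, Function.update (fun _ => []) k₁ (eb (f a))⟩ := by
      unfold haltList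
      congr 1
      funext k
      exact dite_eq_update k₁ k (eb (f a)) _ (fun _ => List.map_id _)
    rw [h₀, h₁, Function.iterate_add_apply]
    erw [hv]
    rfl
  choose t ht h using key
  exact ⟨⟨t, h⟩, ht⟩

end Prog

namespace Prog

section RunIn

variable {K : Type} [DecidableEq K] {p q : Prog K} {s s' s₁ : K → List Bool} {T T' : ℕ} {k : K}
  {l : List Bool}

theorem RunIn.mono (h : RunIn p s s' T) (hT : T ≤ T') : RunIn p s s' T' := by
  obtain ⟨t, ht, hr⟩ := h
  exact ⟨t, ht.trans hT, hr⟩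

theorem RunIn.conv (h : RunIn p s s₁ T) (hs : s₁ = s') (hT : T ≤ T') : RunIn p s s' T' :=
  hs ▸ h.mono hT

theorem RunIn.skip (s : K → List Bool) : RunIn Prog.skip s s 1 := ⟨1, le_rfl, Run.skip s⟩

theorem RunIn.push {b : Bool} (h : Function.update s k (b :: s k) = s') :
    RunIn (Prog.push k b) s s' 1 := ⟨1, le_rfl, h ▸ Run.push k b s⟩

theorem RunIn.seq (h₁ : RunIn p s s₁ T) (h₂ : RunIn q s₁ s' T') :
    RunIn (Prog.seq p q) s s' (T + T') := by
  obtain ⟨t, ht, hr⟩ := h₁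
  obtain ⟨t', ht', hr'⟩ := h₂
  exact ⟨t' + t, by omega, hr.seq hr'⟩

theorem RunIn.popNil {pn pt pf : Prog K} (hk : s k = []) (h : RunIn pn s s' T) :
    RunIn (popCase k pn pt pf) s s' (T + 1) := by
  obtain ⟨t, ht, hr⟩ := h
  exact ⟨t + 1, by omega, Run.popNil hk hr⟩

theorem RunIn.popTrue {pn pt pf : Prog K} (hk : s k = true :: l)
    (h : RunIn pt (Function.update s k l) s' T) : RunIn (popCase k pn pt pf) s s' (T + 1) := by
  obtain ⟨t, ht, hr⟩ := h
  exact ⟨t + 1, by omega, Run.popTrue hk hr⟩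

theorem RunIn.popFalse {pn pt pf : Prog K} (hk : s k = false :: l)
    (h : RunIn pf (Function.update s k l) s' T) : RunIn (popCase k pn pt pf) s s' (T + 1) := by
  obtain ⟨t, ht, hr⟩ := h
  exact ⟨t + 1, by omega, Run.popFalse hk hr⟩

theorem RunIn.loopNil (hk : s k = []) : RunIn (loop k p) s s 1 := ⟨1, le_rfl, Run.loopNil hk⟩

theorem RunIn.loopFalse (hk : s k = false :: l) (h : Function.update s k l = s') :
    RunIn (loop k p) s s' 1 := ⟨1, le_rfl, h ▸ Run.loopFalse hk⟩

theorem RunIn.loopTrue (hk : s k = true :: l) (h₁ : RunIn p (Function.update s k l) s₁ T)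
    (h₂ : RunIn (loop k p) s₁ s' T') : RunIn (loop k p) s s' (T + 1 + T') := by
  obtain ⟨t, ht, hr⟩ := h₁
  obtain ⟨t', ht', hr'⟩ := h₂
  exact ⟨t' + t + 1, by omega, Run.loopTrue hk hr hr'⟩

end RunIn

end Prog

/-! ### Counter programs -/

/-- The stacks used by counter programs: input, output, a work stack, three scratch counters, and
for every counter a stack with its value and a stack with the complementary value. -/
inductive Stk (D : Type) : Type
  | inp | out | rev | t₁ | t₂ | ne
  | up (c : D)
  | dn (c : D)
  deriving DecidableEq, Fintype

/-- The contents of the three data stacks. -/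
structure Data where
  /-- input -/
  inp : List Bool
  /-- work stack -/
  rev : List Bool
  /-- output -/
  out : List Bool

/-- The memory with counter values `v`, complementary values `d` and scratch counters `a b e`. -/
def mem {D : Type} (v d : D → ℕ) (a b e : ℕ) (r : Data) : Stk D → List Bool
  | .inp => r.inp
  | .out => r.out
  | .rev => r.rev
  | .t₁ => List.replicate a true
  | .t₂ => List.replicate b true
  | .ne => List.replicate e true
  | .up c => List.replicate (v c) true
  | .dn c => List.replicate (d c) true

/-! ### Unary counters on stacks: transfer, clearing and comparison. -/

section mem

variable {D : Type} [DecidableEq D] (v d : D → ℕ) (a b e : ℕ) (r : Data) (l : List Bool) (m : ℕ)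
  (c : D)

open Function

@[simp] theorem update_mem_inp : update (mem v d a b e r) .inp l =
    mem v d a b e { r with inp := l } := by
  funext k; cases k <;> simp [mem, update]

@[simp] theorem update_mem_out : update (mem v d a b e r) .out l =
    mem v d a b e { r with out := l } := by
  funext k; cases k <;> simp [mem, update]

@[simp] theorem update_mem_rev : update (mem v d a b e r) .rev l =
    mem v d a b e { r with rev := l } := by
  funext k; cases k <;> simp [mem, update]

@[simp] theorem update_mem_t₁ : update (mem v d a b e r) .t₁ (List.replicate m true) =
    mem v d m b e r := by
  funext k; cases k <;> simp [mem, update]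

@[simp] theorem update_mem_t₂ : update (mem v d a b e r) .t₂ (List.replicate m true) =
    mem v d a m e r := by
  funext k; cases k <;> simp [mem, update]

@[simp] theorem update_mem_ne : update (mem v d a b e r) .ne (List.replicate m true) =
    mem v d a b m r := by
  funext k; cases k <;> simp [mem, update]

@[simp] theorem update_mem_up : update (mem v d a b e r) (.up c) (List.replicate m true) =
    mem (update v c m) d a b e r := by
  funext k; cases k <;> simp [mem, update]
  split_ifs <;> rfl

@[simp] theorem update_mem_dn : update (mem v d a b e r) (.dn c) (List.replicate m true) =
    mem v (update d c m) a b e r := by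
  funext k; cases k <;> simp [mem, update]
  split_ifs <;> rfl

open Prog

theorem runIn_push_t₁ : RunIn (push (.t₁ : Stk D) true) (mem v d a b e r)
    (mem v d (a + 1) b e r) 1 := .push (update_mem_t₁ v d a b e r (a + 1))

theorem runIn_push_t₂ : RunIn (push (.t₂ : Stk D) true) (mem v d a b e r)
    (mem v d a (b + 1) e r) 1 := .push (update_mem_t₂ v d a b e r (b + 1))

theorem runIn_push_ne : RunIn (push (.ne : Stk D) true) (mem v d a b e r)
    (mem v d a b (e + 1) r) 1 := .push (update_mem_ne v d a b e r (e + 1))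

theorem runIn_push_up : RunIn (push (.up c) true) (mem v d a b e r)
    (mem (update v c (v c + 1)) d a b e r) 1 := .push (update_mem_up v d a b e r (v c + 1) c)

theorem runIn_push_dn : RunIn (push (.dn c) true) (mem v d a b e r)
    (mem v (update d c (d c + 1)) a b e r) 1 := .push (update_mem_dn v d a b e r (d c + 1) c)

theorem runIn_restore_t₁ : RunIn (loop .t₁ (push (.up c) true)) (mem v d a b e r)
    (mem (update v c (v c + a)) d 0 b e r) (2 * a + 1) := by
  induction a generalizing v with
  | zero => simpa using RunIn.loopNil (p := push (.up c) true) (s := mem v d 0 b e r) (k := .t₁) rfl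
  | succ a ih =>
    have h := ih (update v c (v c + 1))
    refine RunIn.conv (RunIn.loopTrue (l := List.replicate a true) (T := 1) ?_ ?_ h) ?_ (by omega)
    · simp [mem, *, List.replicate_succ]
    · rw [update_mem_t₁]
      exact runIn_push_up ..
    · simp [add_comm, add_left_comm]

theorem runIn_restore_t₂ : RunIn (loop .t₂ (push (.up c) true)) (mem v d a b e r)
    (mem (update v c (v c + b)) d a 0 e r) (2 * b + 1) := by
  induction b generalizing v with
  | zero => simpa using RunIn.loopNil (p := push (.up c) true) (s := mem v d a 0 e r) (k := .t₂) rfl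
  | succ b ih =>
    have h := ih (update v c (v c + 1))
    refine RunIn.conv (RunIn.loopTrue (l := List.replicate b true) (T := 1) ?_ ?_ h) ?_ (by omega)
    · simp [mem, *, List.replicate_succ]
    · rw [update_mem_t₂]
      exact runIn_push_up ..
    · simp [add_comm, add_left_comm]

theorem runIn_restore_dn : RunIn (loop (.dn c) (push (.up c) true)) (mem v d a b e r)
    (mem (update v c (v c + d c)) (update d c 0) a b e r) (2 * d c + 1) := by
  induction h : d c generalizing v d with
  | zero =>
    rw [← h, update_eq_self, h, add_zero, update_eq_self]
    exact RunIn.loopNil (by simp [mem, h])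
  | succ m ih =>
    have h' := ih (update v c (v c + 1)) (update d c m) (by simp)
    refine RunIn.conv (RunIn.loopTrue (l := List.replicate m true) (T := 1) ?_ ?_ h') ?_ (by omega)
    · simp [mem, *, List.replicate_succ]
    · rw [update_mem_dn]
      exact runIn_push_up ..
    · simp [add_comm, add_left_comm]

theorem runIn_clear_ne : RunIn (loop .ne skip) (mem v d a b e r) (mem v d a b 0 r)
    (2 * e + 1) := by
  induction e with
  | zero => exact RunIn.loopNil rfl
  | succ e ih =>
    refine RunIn.conv (RunIn.loopTrue (l := List.replicate e true) (T := 1) ?_ ?_ ih) ?_ (by omega)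
    · simp [mem, *, List.replicate_succ]
    · rw [update_mem_ne]
      exact .skip _
    · rfl

theorem runIn_clear_up : RunIn (loop (.up c) skip) (mem v d a b e r)
    (mem (update v c 0) d a b e r) (2 * v c + 1) := by
  induction h : v c generalizing v with
  | zero =>
    refine RunIn.conv (RunIn.loopNil (by simp [mem, h])) ?_ (by omega)
    rw [← h, update_eq_self]
  | succ m ih =>
    have h' := ih (update v c m) (by simp)
    rw [update_idem] at h'
    refine RunIn.conv (RunIn.loopTrue (l := List.replicate m true) (T := 1) ?_ ?_ h') ?_ (by omega)
    · simp [mem, *, List.replicate_succ]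
    · rw [update_mem_up]
      exact .skip _
    · rfl

-- Each unit taken from `c` is recorded in `t₁`. It is matched with a unit of `c'`, recorded in
-- `t₂`, or flagged in `ne` once `c'` is empty. The records allow both counters to be restored
-- afterwards.
variable {c} in
theorem runIn_compare {c' : D} (hc : c ≠ c') :
    RunIn (loop (.up c) (seq (push .t₁ true)
        (popCase (.up c') (push .ne true) (push .t₂ true) skip)))
      (mem v d a b e r)
      (mem (update (update v c 0) c' (v c' - v c)) d (a + v c) (b + min (v c) (v c'))
        (e + (v c - v c')) r) (4 * v c + 1) := by
  induction h : v c generalizing v a b e with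
  | zero =>
    refine RunIn.conv (RunIn.loopNil (by simp [mem, h])) ?_ (by omega)
    rw [← h, update_eq_self]
    simp [h]
  | succ m ih =>
    rcases h' : v c' with _ | y
    · have h₁ := ih (update v c m) (a + 1) b (e + 1) (by simp)
      refine RunIn.conv
        (RunIn.loopTrue (l := List.replicate m true) (T := 3) ?_ ?_ h₁) ?_ (by omega)
      · simp [mem, *, List.replicate_succ]
      · rw [update_mem_up]
        refine (runIn_push_t₁ ..).seq (RunIn.popNil ?_ (runIn_push_ne ..))
        simp [mem, hc.symm, h']
      · simp [hc.symm, h', add_comm, add_left_comm]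
    · have h₁ := ih (update (update v c m) c' y) (a + 1) (b + 1) e (by simp [hc])
      refine RunIn.conv
        (RunIn.loopTrue (l := List.replicate m true) (T := 3) ?_ ?_ h₁) ?_ (by omega)
      · simp [mem, *, List.replicate_succ]
      · rw [update_mem_up]
        refine RunIn.seq (T' := 2) (runIn_push_t₁ ..)
          (RunIn.popTrue (l := List.replicate y true) (T := 1) ?_ ?_)
        · simp [mem, hc.symm, h', List.replicate_succ]
        · rw [update_mem_up]
          exact runIn_push_t₂ ..
      · congr 1
        · funext x
          simp only [update_apply]
          split_ifs <;> simp_all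
        all_goals simp only [update_apply, hc.symm, if_true, if_false, add_assoc]; omega

end mem

/-! ### Loop programs over bounded counters, their meaning and running time. -/

section Cmd

/-- Programs working with counters, for which a denotation and a running time are computed. -/
inductive Cmd (D : Type) : Type
  | skip : Cmd D
  | out (b : Bool) : Cmd D
  /-- move a bit from the work stack to the output -/
  | move : Cmd D
  /-- move a bit from the input to the work stack -/
  | read : Cmd D
  | seq (p q : Cmd D) : Cmd D
  /-- run through all values of the counter `c` below its bound, in descending order -/
  | forAll (c : D) (p : Cmd D) : Cmd D
  | ifEq (c c' : D) (p q : Cmd D) : Cmd D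

/-- `iterDown F N` applies `F (N - 1)`, …, `F 1`, `F 0` in this order. -/
def iterDown {α : Type} (F : ℕ → α → α) : ℕ → α → α
  | 0, r => r
  | N + 1, r => iterDown F N (F N r)

/-- Move the first bit of the first list, if there is one, to the second list. -/
def moveBit : List Bool → List Bool → List Bool × List Bool
  | [], l' => ([], l')
  | b :: l, l' => (l, b :: l')

namespace Cmd

variable {D : Type} [DecidableEq D] (B : D → ℕ)

/-- The effect of a command on the data stacks when the counters are bounded by `B` and have the
values `v`. -/
def den : Cmd D → (D → ℕ) → Data → Data
  | skip, _, r => r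
  | out b, _, r => { r with out := b :: r.out }
  | move, _, r => { r with rev := (moveBit r.rev r.out).1, out := (moveBit r.rev r.out).2 }
  | read, _, r => { r with inp := (moveBit r.inp r.rev).1, rev := (moveBit r.inp r.rev).2 }
  | seq p q, v, r => q.den v (p.den v r)
  | forAll c p, v, r => iterDown (fun j => p.den (Function.update v c j)) (B c) r
  | ifEq c c' p q, v, r => if v c = v c' then p.den v r else q.den v r

/-- The running time in terms of a bound on all counters. -/
noncomputable def time : Cmd D → Polynomial ℕ
  | skip => 1
  | out _ => 1
  | move => 2
  | read => 2
  | seq p q => p.time + q.time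
  | forAll _ p => Polynomial.X * (p.time + 4) + 2
  | ifEq _ _ p q => 12 * Polynomial.X + 12 + p.time + q.time

/-- A loop may only use a counter that is not in use, and the counters that are compared are
distinct. -/
def OK : Cmd D → (D → ℕ) → Prop
  | skip, _ => True
  | out _, _ => True
  | move, _ => True
  | read, _ => True
  | seq p q, v => p.OK v ∧ q.OK v
  | forAll c p, v => v c = B c ∧ ∀ j < B c, p.OK (Function.update v c j)
  | ifEq c c' p q, v => c ≠ c' ∧ p.OK v ∧ q.OK v

open Prog in
/-- The translation of counter programs into stack programs. -/
def toProg : Cmd D → Prog (Stk D)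
  | skip => .skip
  | out b => push .out b
  | move => popCase .rev .skip (push .out true) (push .out false)
  | read => popCase .inp .skip (push .rev true) (push .rev false)
  | seq p q => p.toProg.seq q.toProg
  | forAll c p => (loop (.up c) ((push (.dn c) true).seq p.toProg)).seq
      (loop (.dn c) (push (.up c) true))
  | ifEq c c' p q =>
    (loop (.up c) (.seq (push .t₁ true)
      (popCase (.up c') (push .ne true) (push .t₂ true) .skip))).seq <|
    (popCase (.up c') .skip ((push (.up c') true).seq (push .ne true)) .skip).seq <|
    (loop .t₁ (push (.up c) true)).seq <|
    (loop .t₂ (push (.up c') true)).seq <|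
    popCase .ne p.toProg ((loop .ne .skip).seq q.toProg) .skip

/-- The memory with counter values `v`. -/
def conc (v : D → ℕ) (r : Data) : Stk D → List Bool := mem v (fun c => B c - v c) 0 0 0 r

open Prog

theorem update_conc_inp (v : D → ℕ) (r : Data) (l : List Bool) :
    Function.update (conc B v r) .inp l = conc B v { r with inp := l } := update_mem_inp ..

theorem update_conc_out (v : D → ℕ) (r : Data) (l : List Bool) :
    Function.update (conc B v r) .out l = conc B v { r with out := l } := update_mem_out ..

theorem update_conc_rev (v : D → ℕ) (r : Data) (l : List Bool) :
    Function.update (conc B v r) .rev l = conc B v { r with rev := l } := update_mem_rev ..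

/-- The loop moves units from `up c` to `dn c`, whose sum stays `B c`. A unit is popped before the
body runs, so the body sees the values `B c - 1` down to `0`; the second loop then refills `up c`.
-/
theorem runIn_for {c : D} {p : Prog (Stk D)} {v : D → ℕ} {F : ℕ → Data → Data} {T : ℕ}
    (hv : v c = B c) (h : ∀ j < B c, ∀ r, RunIn p (conc B (Function.update v c j) r)
      (conc B (Function.update v c j) (F j r)) T) (r : Data) :
    RunIn ((loop (.up c) ((push (.dn c) true).seq p)).seq (loop (.dn c) (push (.up c) true)))
      (conc B v r) (conc B v (iterDown F (B c) r)) (B c * (T + 4) + 2) := by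
  have h₁ : ∀ N ≤ B c, ∀ r, RunIn (loop (.up c) ((push (.dn c) true).seq p))
      (conc B (Function.update v c N) r) (conc B (Function.update v c 0) (iterDown F N r))
      (N * (T + 2) + 1) := by
    intro N
    induction N with
    | zero => intro _ r; exact .conv (.loopNil (by simp [conc, mem])) rfl (by omega)
    | succ N ih =>
      intro hN r
      refine RunIn.conv (RunIn.loopTrue (l := List.replicate N true) (T := 1 + T) ?_
        (.seq (s₁ := conc B (Function.update v c N) r) ?_ (h N (by omega) r))
        (ih (by omega) _)) rfl (by rw [Nat.succ_mul]; omega)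
      · simp [conc, mem, List.replicate_succ]
      · unfold conc
        rw [update_mem_up]
        refine (runIn_push_dn ..).conv ?_ le_rfl
        congr 1
        · simp
        · funext x
          by_cases hx : x = c
          · rw [hx]
            simp
            omega
          · simp [hx]
  have h₂ := h₁ (B c) le_rfl r
  rw [← hv, Function.update_eq_self, hv] at h₂
  refine (h₂.seq (runIn_restore_dn ..)).conv ?_ ?_
  · unfold conc
    congr 1
    · simp [hv]
    · funext x
      by_cases hx : x = c
      · rw [hx]
        simp [hv]
      · simp [hx]
  · simp [Nat.mul_add]; omega

theorem runIn_ifEq {c c' : D} {p q : Prog (Stk D)} {v : D → ℕ} {M T T' : ℕ}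
    {s : Stk D → List Bool}
    (hc : c ≠ c') (hv : v c ≤ M) (hv' : v c' ≤ M) (r : Data)
    (hp : v c = v c' → RunIn p (conc B v r) s T) (hq : v c ≠ v c' → RunIn q (conc B v r) s T') :
    RunIn ((loop (.up c) (.seq (push .t₁ true)
      (popCase (.up c') (push .ne true) (push .t₂ true) .skip))).seq <|
    (popCase (.up c') .skip ((push (.up c') true).seq (push .ne true)) .skip).seq <|
    (loop .t₁ (push (.up c) true)).seq <|
    (loop .t₂ (push (.up c') true)).seq <|
    popCase .ne p ((loop .ne .skip).seq q) .skip) (conc B v r) s (12 * M + 12 + T + T') := by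
  have h₁ := runIn_compare v (fun c => B c - v c) 0 0 0 r hc
  -- So far `ne` only detects `v c' < v c`. A unit left in `c'` reveals the opposite inequality; it
  -- is put back after setting the flag.
  have h₂ : ∃ e, (e = 0 ↔ v c = v c') ∧ e ≤ M ∧
      RunIn (popCase (.up c') .skip ((push (.up c') true).seq (push .ne true)) .skip)
        (mem (Function.update (Function.update v c 0) c' (v c' - v c)) (fun c => B c - v c)
          (0 + v c) (0 + min (v c) (v c')) (0 + (v c - v c')) r)
        (mem (Function.update (Function.update v c 0) c' (v c' - v c)) (fun c => B c - v c)
          (v c) (min (v c) (v c')) e r) 3 := by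
    rcases h : v c' - v c with _ | m
    · refine ⟨v c - v c', by omega, by omega, .conv (.popNil (by simp [mem]) (.skip _)) ?_
        (by omega)⟩
      simp
    · refine ⟨1, by omega, by omega, .conv (.popTrue (T := 2) (l := List.replicate m true)
        (by simp [mem, List.replicate_succ]) ?_) rfl (by omega)⟩
      rw [update_mem_up]
      refine (RunIn.seq (runIn_push_up ..) (runIn_push_ne ..)).conv ?_ le_rfl
      congr 1
      · simp
      · omega
      · omega
      · omega
  obtain ⟨e, he, heM, h₂⟩ := h₂
  have h₃ := runIn_restore_t₁ (Function.update (Function.update v c 0) c' (v c' - v c))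
    (fun c => B c - v c) (v c) (min (v c) (v c')) e r c
  have h₄ := runIn_restore_t₂ (Function.update (Function.update (Function.update v c 0) c'
    (v c' - v c)) c (Function.update (Function.update v c 0) c' (v c' - v c) c + v c))
    (fun c => B c - v c) 0 (min (v c) (v c')) e r c'
  have hV : ∀ V : D → ℕ, V = v → mem V (fun c => B c - v c) 0 0 e r =
      mem v (fun c => B c - v c) 0 0 e r := fun V hV => by rw [hV]
  rw [hV] at h₄
  · have h₅ : RunIn (popCase .ne p ((loop .ne .skip).seq q) .skip)
        (mem v (fun c => B c - v c) 0 0 e r) s (2 * e + 2 + T + T') := by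
      rcases e with _ | e
      · exact .conv (.popNil rfl (hp (he.1 rfl))) rfl (by omega)
      · refine .conv (.popTrue (l := List.replicate e true) rfl ?_) rfl
          (show 2 * e + 1 + T' + 1 ≤ _ by omega)
        rw [update_mem_ne]
        exact (runIn_clear_ne ..).seq (hq (fun h => by simp [h] at he))
    exact (h₁.seq (h₂.seq (h₃.seq (h₄.seq h₅)))).mono (by omega)
  · funext x
    by_cases hx : x = c'
    · rw [hx]
      simp [hc.symm]
      omega
    · by_cases hx' : x = c
      · rw [hx']
        simp [hc]
      · simp [hx, hx']

theorem runIn_toProg {M : ℕ} (hB : ∀ c, B c ≤ M) (p : Cmd D) (v : D → ℕ) (hv : ∀ c, v c ≤ M)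
    (hp : p.OK B v) (r : Data) :
    RunIn p.toProg (conc B v r) (conc B v (p.den B v r)) (p.time.eval M) := by
  induction p generalizing v r with
  | skip => exact .conv (.skip _) rfl (by simp [time])
  | out b => exact .conv (.push (update_conc_out ..)) rfl (by simp [time])
  | move =>
    simp only [time, Polynomial.eval_ofNat]
    rcases h : r.rev with _ | ⟨_ | _, l⟩
    · refine .conv (.popNil h (.skip _)) ?_ le_rfl
      obtain ⟨_, _, _⟩ := r
      subst h
      rfl
    · refine .conv (.popFalse h (.push rfl)) ?_ le_rfl
      rw [update_conc_rev, update_conc_out]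
      simp [den, h, moveBit, conc, mem]
    · refine .conv (.popTrue h (.push rfl)) ?_ le_rfl
      rw [update_conc_rev, update_conc_out]
      simp [den, h, moveBit, conc, mem]
  | read =>
    simp only [time, Polynomial.eval_ofNat]
    rcases h : r.inp with _ | ⟨_ | _, l⟩
    · refine .conv (.popNil h (.skip _)) ?_ le_rfl
      obtain ⟨_, _, _⟩ := r
      subst h
      rfl
    · refine .conv (.popFalse h (.push rfl)) ?_ le_rfl
      rw [update_conc_inp, update_conc_rev]
      simp [den, h, moveBit, conc, mem]
    · refine .conv (.popTrue h (.push rfl)) ?_ le_rfl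
      rw [update_conc_inp, update_conc_rev]
      simp [den, h, moveBit, conc, mem]
  | seq p q ihp ihq => exact .conv ((ihp v hv hp.1 _).seq (ihq v hv hp.2 _)) rfl (by simp [time])
  | forAll c p ih =>
    refine (runIn_for B hp.1 (fun j hj r => ih (Function.update v c j) ?_ (hp.2 j hj) r) r).conv
      rfl ?_
    · intro x
      rw [Function.update_apply]
      split_ifs
      · exact hj.le.trans (hB c)
      · exact hv x
    · simp only [time, Polynomial.eval_add, Polynomial.eval_mul, Polynomial.eval_X,
        Polynomial.eval_ofNat]
      gcongr
      exact hB c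
  | ifEq c c' p q ihp ihq =>
    simp only [time, Polynomial.eval_add, Polynomial.eval_mul, Polynomial.eval_X,
        Polynomial.eval_ofNat]
    refine runIn_ifEq B hp.1 (hv c) (hv c') r (fun h => ?_) (fun h => ?_)
    · simpa [den, h] using ihp v hv hp.2.1 r
    · simpa [den, h] using ihq v hv hp.2.2 r

end Cmd

end Cmd

/-! ### From encoded instances to loaded counters, and to a Turing machine. -/

section Wrapper

open Prog

variable {D : Type} [DecidableEq D]

/-- Increment all counters in a list. -/
def pushAll : List D → Prog (Stk D)
  | [] => .skip
  | c :: l => .seq (.push (.up c) true) (pushAll l)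

/-- Empty all counters in a list. -/
def clearAll : List D → Prog (Stk D)
  | [] => .skip
  | c :: l => .seq (.loop (.up c) .skip) (clearAll l)

theorem runIn_pushAll (l : List D) (v d : D → ℕ) (a b e : ℕ) (r : Data) :
    RunIn (pushAll l) (mem v d a b e r) (mem (fun c => v c + l.count c) d a b e r)
      (l.length + 1) := by
  induction l generalizing v with
  | nil => exact .conv (.skip _) (by simp) (by simp)
  | cons x l ih =>
    refine (RunIn.seq (runIn_push_up ..) (ih _)).conv ?_ (by simp; omega)
    congr 1
    funext c
    by_cases hc : c = x
    · rw [hc]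
      simp
      omega
    · simp [hc, List.count_cons_of_ne (Ne.symm hc)]

/-- Leaving the loop consumes the separator `false`, so the next loop starts exactly at the next
block of the encoding. -/
theorem runIn_loop_pushAll (l : List D) (v d : D → ℕ) (a b e : ℕ) (N : ℕ) (x y z : List Bool) :
    RunIn (.loop .inp (pushAll l)) (mem v d a b e ⟨List.replicate N true ++ false :: x, y, z⟩)
      (mem (fun c => v c + N * l.count c) d a b e ⟨x, y, z⟩) (N * (l.length + 2) + 1) := by
  induction N generalizing v with
  | zero =>
    refine .conv (.loopFalse (l := x) rfl rfl) ?_ (by simp)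
    simp
  | succ N ih =>
    refine RunIn.conv (RunIn.loopTrue (l := List.replicate N true ++ false :: x)
      (T := l.length + 1) (by simp [mem, List.replicate_succ]) ?_
      (ih fun c => v c + l.count c)) ?_ (by rw [Nat.succ_mul]; omega)
    · rw [update_mem_inp]
      exact runIn_pushAll ..
    · congr 1
      funext c
      rw [Nat.succ_mul]
      omega

theorem runIn_clearAll (M : ℕ) (l : List D) (v d : D → ℕ) (hv : ∀ c, v c ≤ M) (a b e : ℕ)
    (r : Data) : RunIn (clearAll l) (mem v d a b e r)
      (mem (fun c => if c ∈ l then 0 else v c) d a b e r) (l.length * (2 * M + 1) + 1) := by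
  induction l generalizing v with
  | nil => exact .conv (.skip _) (by simp) (by simp)
  | cons x l ih =>
    have hx := hv x
    refine (RunIn.seq (runIn_clear_up ..) (ih (Function.update v x 0) fun c => ?_)).conv ?_ ?_
    · rw [Function.update_apply]
      split_ifs
      · exact Nat.zero_le _
      · exact hv c
    · congr 1
      funext c
      by_cases hc : c = x <;> simp [hc]
    · rw [List.length_cons, Nat.add_mul]
      omega

open Classical in
/-- The rows of the adjacency matrix. -/
noncomputable def GraphInstance.adjBits (I : GraphInstance) : List Bool :=
  (List.finRange I.n).flatMap fun i => (List.finRange I.n).map fun j => decide (I.graph.Adj i j)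

theorem GraphInstance.encode_eq (I : GraphInstance) : I.encode =
    List.replicate I.k true ++ false :: (List.replicate I.n true ++ false :: I.adjBits) := rfl

/-- The counter bounds for an instance. -/
def counterBound (ks ks' ns : List D) (I : GraphInstance) (c : D) : ℕ :=
  I.k * ks.count c + ks'.count c + I.n * ns.count c

theorem counterBound_le (ks ks' ns : List D) (I : GraphInstance) (c : D) :
    counterBound ks ks' ns I c ≤ I.encode.length * (ks.length + ks'.length + ns.length) := by
  have h₁ := List.count_le_length (a := c) (l := ks)
  have h₂ := List.count_le_length (a := c) (l := ks')
  have h₃ := List.count_le_length (a := c) (l := ns)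
  have hk : I.k ≤ I.encode.length := by simp [GraphInstance.encode_eq]
  have hn : I.n ≤ I.encode.length := by simp [GraphInstance.encode_eq]; omega
  -- The summand from `ks'` carries no factor from the instance; a nonempty encoding absorbs it.
  have h0 : 1 ≤ I.encode.length := by simp [GraphInstance.encode_eq]; omega
  calc counterBound ks ks' ns I c
      ≤ I.encode.length * ks.length + I.encode.length * ks'.length
        + I.encode.length * ns.length := by
        unfold counterBound
        gcongr
        nlinarith
    _ = _ := by ring

/-- A counter program that computes the map `f` on instances from the adjacency matrix and the two
numbers in the instance yields a polynomial-time Turing machine for `f`. -/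
theorem nonempty_tm2ComputableInPolyTime_of_cmd [Fintype D] {f : GraphInstance → GraphInstance}
    (p : Cmd D) (ks ks' ns : List D)
    (hp : ∀ I, p.OK (counterBound ks ks' ns I) (counterBound ks ks' ns I))
    (h : ∀ I, p.den (counterBound ks ks' ns I) (counterBound ks ks' ns I) ⟨I.adjBits, [], []⟩ =
      ⟨[], [], (f I).encode⟩) :
    Nonempty (Turing.TM2ComputableInPolyTime GraphInstance.encode GraphInstance.encode f) := by
  let m := ks.length + ks'.length + ns.length
  -- The machine loads the counters, runs the program, and clears all counters, because only the
  -- output stack may be nonempty at the end.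
  refine nonempty_tm2ComputableInPolyTime
    (((Prog.loop .inp (pushAll ks)).seq ((pushAll ks').seq (.loop .inp (pushAll ns)))).seq
      (p.toProg.seq (clearAll (Finset.univ : Finset D).toList))) .inp .out
    ((.X * .C (ks.length + 2) + 1 + (.C (ks'.length + 1) + (.X * .C (ns.length + 2) + 1))) +
      (p.time.comp (.X * .C m) + (.C (Fintype.card D) * (2 * (.X * .C m) + 1) + 1))) fun I => ?_
  set B := counterBound ks ks' ns I
  have hk : I.k ≤ I.encode.length := by simp [GraphInstance.encode_eq]
  have hn : I.n ≤ I.encode.length := by simp [GraphInstance.encode_eq]; omega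
  have hM := counterBound_le ks ks' ns I
  have h₀ : Function.update (fun _ => []) .inp I.encode =
      mem (D := D) (fun _ => 0) (fun _ => 0) 0 0 0 ⟨I.encode, [], []⟩ := by
    funext k; cases k <;> simp [mem, Function.update]
  have h₁ : Function.update (fun _ => []) .out (f I).encode =
      mem (D := D) (fun _ => 0) (fun _ => 0) 0 0 0 ⟨[], [], (f I).encode⟩ := by
    funext k; cases k <;> simp [mem, Function.update]
  have hB : ∀ r, Cmd.conc B B r = mem B (fun _ => 0) 0 0 0 r := fun r => by
    simp [Cmd.conc]
  rw [h₀, h₁]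
  have hs : RunIn ((Prog.loop .inp (pushAll ks)).seq
      ((pushAll ks').seq (.loop .inp (pushAll ns))))
      (mem (fun _ => 0) (fun _ => 0) 0 0 0 ⟨I.encode, [], []⟩)
      (Cmd.conc B B ⟨I.adjBits, [], []⟩)
      (I.k * (ks.length + 2) + 1 + ((ks'.length + 1) + (I.n * (ns.length + 2) + 1))) := by
    rw [hB, GraphInstance.encode_eq]
    refine .conv (.seq (runIn_loop_pushAll ..)
      (.seq (runIn_pushAll ..) (runIn_loop_pushAll ..))) ?_ le_rfl
    congr 1
    funext c
    simp [B, counterBound]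
  have hr := Cmd.runIn_toProg B hM p B hM (hp I) ⟨I.adjBits, [], []⟩
  rw [h] at hr
  have hc := runIn_clearAll _ (Finset.univ : Finset D).toList B (fun _ => 0) hM 0 0 0
    ⟨[], [], (f I).encode⟩
  rw [← hB] at hc
  refine (hs.seq (hr.seq hc)).conv ?_ ?_
  · congr 1
    simp
  · simp only [Polynomial.eval_add, Polynomial.eval_mul, Polynomial.eval_X, Polynomial.eval_C,
      Polynomial.eval_comp, Polynomial.eval_one, Polynomial.eval_ofNat, Finset.length_toList,
      Finset.card_univ]
    gcongr

end Wrapper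

/-! ### The output of counter programs -/

/-- All valuations obtained from `v` by assigning to the counters in a list values below their
bounds. -/
def enum {D : Type} [DecidableEq D] (B : D → ℕ) : List D → (D → ℕ) → List (D → ℕ)
  | [], v => [v]
  | c :: cs, v => (List.range (B c)).flatMap fun j => enum B cs (Function.update v c j)

namespace Cmd

section Emits

variable {D : Type} [DecidableEq D] (B : D → ℕ)

/-- With the counter values `v` the command `p` removes the list `a` from the work stack, where it
is stored in reverse, and puts the list `l` in front of the output. -/
def Emits (p : Cmd D) (v : D → ℕ) (a l : List Bool) : Prop :=
  p.OK B v ∧ ∀ x a₀ o, p.den B v ⟨x, (a₀ ++ a).reverse, o⟩ = ⟨x, a₀.reverse, l ++ o⟩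

variable {B} {v : D → ℕ}

theorem emits_skip : Emits B skip v [] [] := ⟨trivial, fun x a₀ o => by simp [den]⟩

theorem emits_out (b : Bool) : Emits B (out b) v [] [b] := ⟨trivial, fun x a₀ o => by simp [den]⟩

theorem emits_move (b : Bool) : Emits B move v [b] [b] :=
  ⟨trivial, fun x a₀ o => by simp [den, moveBit]⟩

/-- Output is prepended and the work stack is popped from the end of the list, so the program run
first accounts for the later segments. -/
theorem Emits.seq {p q : Cmd D} {a₁ a₂ l₁ l₂ : List Bool} (hp : Emits B p v a₂ l₂)
    (hq : Emits B q v a₁ l₁) : Emits B (seq p q) v (a₁ ++ a₂) (l₁ ++ l₂) :=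
  ⟨⟨hp.1, hq.1⟩, fun x a₀ o => by
    rw [den, ← List.append_assoc, hp.2, hq.2, List.append_assoc]⟩

theorem emits_for {c : D} {p : Cmd D} {a l : ℕ → List Bool} (hc : v c = B c)
    (h : ∀ j < B c, Emits B p (Function.update v c j) (a j) (l j)) :
    Emits B (.forAll c p) v ((List.range (B c)).flatMap a) ((List.range (B c)).flatMap l) := by
  refine ⟨⟨hc, fun j hj => (h j hj).1⟩, ?_⟩
  suffices ∀ N ≤ B c, ∀ x a₀ o, iterDown (fun j => p.den B (Function.update v c j)) N
      ⟨x, (a₀ ++ (List.range N).flatMap a).reverse, o⟩ =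
      ⟨x, a₀.reverse, (List.range N).flatMap l ++ o⟩ from this _ le_rfl
  intro N
  induction N with
  | zero => intro _ x a₀ o; simp [iterDown]
  | succ N ih =>
    intro hN x a₀ o
    rw [iterDown, List.range_succ, List.flatMap_append, List.flatMap_singleton,
      ← List.append_assoc, (h N hN).2, ih (by omega), List.flatMap_append, List.flatMap_singleton,
      List.append_assoc]

theorem emits_ifEq {c c' : D} {p q : Cmd D} {a : List Bool} {l : List Bool} (hc : c ≠ c')
    (hp : p.OK B v) (hq : q.OK B v) (h : v c = v c' → Emits B p v a l)
    (h' : v c ≠ v c' → Emits B q v a l) : Emits B (.ifEq c c' p q) v a l := by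
  refine ⟨⟨hc, hp, hq⟩, fun x a₀ o => ?_⟩
  rw [den]
  split_ifs with hv
  · exact (h hv).2 x a₀ o
  · exact (h' hv).2 x a₀ o

/-- Write `b` if one of the pairs of counters has equal values and `b'` otherwise. -/
def anyEq (b b' : Bool) : List (D × D) → Cmd D
  | [] => out b'
  | x :: l => .ifEq x.1 x.2 (out b) (anyEq b b' l)

/-- Write `b` if all of the pairs of counters have equal values and `b'` otherwise. -/
def allEq (b b' : Bool) : List (D × D) → Cmd D
  | [] => out b
  | x :: l => .ifEq x.1 x.2 (allEq b b' l) (out b')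

theorem emits_anyEq (b b' : Bool) (l : List (D × D)) (hl : ∀ x ∈ l, x.1 ≠ x.2) :
    Emits B (anyEq b b' l) v [] [if ∃ x ∈ l, v x.1 = v x.2 then b else b'] := by
  induction l with
  | nil => simpa [anyEq] using emits_out b'
  | cons x l ih =>
    have ih := ih fun y hy => hl y (List.mem_cons_of_mem _ hy)
    refine emits_ifEq (hl x List.mem_cons_self) trivial ih.1 (fun h => ?_) (fun h => ?_)
    · rw [if_pos ⟨x, List.mem_cons_self, h⟩]
      exact emits_out b
    · have hx : (∃ y ∈ x :: l, v y.1 = v y.2) ↔ ∃ y ∈ l, v y.1 = v y.2 := by simp [h]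
      simp only [hx]
      exact ih

theorem emits_allEq (b b' : Bool) (l : List (D × D)) (hl : ∀ x ∈ l, x.1 ≠ x.2) :
    Emits B (allEq b b' l) v [] [if ∀ x ∈ l, v x.1 = v x.2 then b else b'] := by
  induction l with
  | nil => simpa [allEq] using emits_out b
  | cons x l ih =>
    have ih := ih fun y hy => hl y (List.mem_cons_of_mem _ hy)
    refine emits_ifEq (hl x List.mem_cons_self) ih.1 trivial (fun h => ?_) (fun h => ?_)
    · have hx : (∀ y ∈ x :: l, v y.1 = v y.2) ↔ ∀ y ∈ l, v y.1 = v y.2 := by simp [h]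
      simp only [hx]
      exact ih
    · rw [if_neg fun hx => h (hx x List.mem_cons_self)]
      exact emits_out b'

/-- Nested loops over a list of counters. -/
def forList (p : Cmd D) : List D → Cmd D
  | [] => p
  | c :: cs => .forAll c (forList p cs)

theorem emits_forList {p : Cmd D} {a l : (D → ℕ) → List Bool} (cs : List D) (hn : cs.Nodup)
    (hv : ∀ c ∈ cs, v c = B c) (h : ∀ v' ∈ enum B cs v, Emits B p v' (a v') (l v')) :
    Emits B (forList p cs) v ((enum B cs v).flatMap a) ((enum B cs v).flatMap l) := by
  induction cs generalizing v with
  | nil => simpa [enum, forList] using h v (by simp [enum])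
  | cons c cs ih =>
    rw [List.nodup_cons] at hn
    simp only [enum, List.flatMap_assoc]
    refine emits_for (hv c List.mem_cons_self) fun j hj => ih hn.2 (fun c' hc' => ?_)
      fun v' hv' => h v' ?_
    · rw [Function.update_of_ne (fun (h : c' = c) => hn.1 (h ▸ hc'))]
      exact hv c' (List.mem_cons_of_mem _ hc')
    · rw [enum, List.mem_flatMap]
      exact ⟨j, List.mem_range.2 hj, hv'⟩

/-- Run `p w` for the elements `w` of a list, the last one first. -/
def seqList {W : Type} (p : W → Cmd D) : List W → Cmd D
  | [] => skip
  | w :: ws => seq (seqList p ws) (p w)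

theorem emits_seqList {W : Type} {p : W → Cmd D} {a l : W → List Bool} (ws : List W)
    (h : ∀ w ∈ ws, Emits B (p w) v (a w) (l w)) :
    Emits B (seqList p ws) v (ws.flatMap a) (ws.flatMap l) := by
  induction ws with
  | nil => exact emits_skip
  | cons w ws ih =>
    exact (ih fun w' hw' => h w' (List.mem_cons_of_mem _ hw')).seq (h w List.mem_cons_self)

theorem den_for_read {c : D} {n : ℕ} {a r o : List Bool} (hn : B c = n) (x : List Bool)
    (ha : a.length = n) :
    (Cmd.forAll c read).den B v ⟨a ++ x, r, o⟩ = ⟨x, a.reverse ++ r, o⟩ := by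
  rw [den, hn]
  subst ha
  clear hn
  induction a generalizing r with
  | nil => rfl
  | cons b a ih =>
    rw [List.length_cons, iterDown]
    refine ih.trans ?_
    simp [moveBit]

theorem den_for_for_read {c c' : D} {n m : ℕ} {r o : List Bool} (hn : B c = n) (hm : B c' = m)
    (a : List Bool) (ha : a.length = n * m) :
    (Cmd.forAll c (.forAll c' read)).den B v ⟨a, r, o⟩ = ⟨[], a.reverse ++ r, o⟩ := by
  rw [den, hn]
  clear hn
  induction n generalizing a r with
  | zero =>
    rw [Nat.zero_mul] at ha
    simp [iterDown, List.length_eq_zero_iff.1 ha]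
  | succ n ih =>
    have hl : (a.take m).length = m := by
      rw [List.length_take, ha, Nat.succ_mul]
      omega
    have h := den_for_read (B := B) (v := Function.update v c n) (r := r) (o := o) hm (a.drop m) hl
    rw [List.take_append_drop] at h
    rw [iterDown, h, ih (a.drop m) (by rw [List.length_drop, ha, Nat.succ_mul]; omega),
      ← List.append_assoc, ← List.reverse_append, List.take_append_drop]

end Emits

end Cmd

/-! ### The reduction as a counter program -/

/-- The counters of the reduction: one for `k`, and for the rows and the columns of the adjacency
matrix of the constructed graph one for the old vertices and a family for the new vertices. -/
inductive Ctr (V : Type) : Type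
  | k
  | old (s : Bool)
  | idx (s : Bool) (i : Option V)
  deriving DecidableEq, Fintype

/-- A description of the vertices of the constructed graph: the old vertices, and the new vertices,
which are copies of vertices in `V` indexed by functions. -/
abbrev RawVertex (V : Type) : Type := ℕ ⊕ (V × (Option V → ℕ))

/-- The bounds on the indices of a new vertex. -/
def idxBound {V : Type} (n k : ℕ) : Option V → ℕ
  | none => k + 1
  | some _ => n

/-- The bounds on the counters. -/
def ctrBound {V : Type} (n k : ℕ) : Ctr V → ℕ
  | .k => k
  | .old _ => n
  | .idx _ i => idxBound n k i

section Reduction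

variable {V : Type} [Fintype V] [DecidableEq V]

/-- The list of all vertices of the constructed graph, where `W` lists the vertices to be copied. -/
noncomputable def rawVertices (W : List V) (n k : ℕ) : List (RawVertex V) :=
  (List.range n).map Sum.inl ++ W.flatMap fun w =>
    (enum (idxBound n k) (Finset.univ : Finset (Option V)).toList (idxBound n k)).map
      fun g => Sum.inr (w, g)

/-- Set the counters of a family. -/
def setIdx (s : Bool) (g : Option V → ℕ) (v : Ctr V → ℕ) : Ctr V → ℕ
  | .idx s' i => if s' = s then g i else v (.idx s' i)
  | c => v c

/-- Running through the counters of one family amounts to running through index functions `g`, with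
all other counters left alone. -/
theorem enum_map_idx (n k : ℕ) (s : Bool) (is : List (Option V)) (g : Option V → ℕ)
    (v : Ctr V → ℕ) : enum (ctrBound n k) (is.map (Ctr.idx s)) (setIdx s g v) =
      (enum (idxBound n k) is g).map fun g => setIdx s g v := by
  induction is generalizing g with
  | nil => rfl
  | cons i is ih =>
    simp only [List.map_cons, enum, List.map_flatMap]
    refine List.flatMap_congr fun j _ => ?_
    rw [← ih]
    congr 1
    funext c
    rcases c with _ | _ | ⟨s', i'⟩
    · simp [setIdx]
    · simp [setIdx]
    · by_cases hs : s' = s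
      · subst hs
        by_cases hi : i' = i
        · subst hi
          simp [setIdx]
        · simp [setIdx, hi]
      · simp [setIdx, hs]

namespace Cmd

/-- Run through all vertices of the constructed graph. -/
noncomputable def forVertices (s : Bool) (W : List V) (p : Cmd (Ctr V)) (q : V → Cmd (Ctr V)) :
    Cmd (Ctr V) :=
  seq (seqList (fun w => forList (q w)
    ((Finset.univ : Finset (Option V)).toList.map (Ctr.idx s))) W) (.forAll (.old s) p)

theorem emits_forVertices {n k : ℕ} {s : Bool} {W : List V} {p : Cmd (Ctr V)}
    {q : V → Cmd (Ctr V)} {v : Ctr V → ℕ} {a l : RawVertex V → List Bool}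
    (hold : v (.old s) = n) (hidx : ∀ i, v (.idx s i) = idxBound n k i)
    (hp : ∀ j < n, Emits (ctrBound n k) p (Function.update v (.old s) j) (a (.inl j)) (l (.inl j)))
    (hq : ∀ w ∈ W, ∀ g, Emits (ctrBound n k) (q w) (setIdx s g v) (a (.inr (w, g)))
      (l (.inr (w, g)))) :
    Emits (ctrBound n k) (forVertices s W p q) v ((rawVertices W n k).flatMap a)
      ((rawVertices W n k).flatMap l) := by
  -- Idle counters hold their bounds, so `v` already has the form required by `enum_map_idx`.
  have hv : v = setIdx s (idxBound n k) v := by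
    funext c
    rcases c with _ | _ | ⟨s', i'⟩
    · rfl
    · rfl
    · simp only [setIdx]
      split_ifs with hs
      · rw [hs, hidx]
      · rfl
  simp only [rawVertices, List.flatMap_append, List.flatMap_map, List.flatMap_assoc]
  -- New vertices are run through first although they come last in `rawVertices`, since output grows
  -- at the front.
  refine Emits.seq ?_ (emits_for hold hp)
  refine emits_seqList W fun w hw => ?_
  have h := emits_forList (B := ctrBound n k) (v := v) (p := q w)
    (a := fun v' => a (.inr (w, fun i => v' (.idx s i))))
    (l := fun v' => l (.inr (w, fun i => v' (.idx s i))))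
    ((Finset.univ : Finset (Option V)).toList.map (Ctr.idx s))
    ((Finset.nodup_toList _).map fun i j h => by simpa using h)
    (by simp [hidx, ctrBound])
  have hE : enum (ctrBound n k) ((Finset.univ : Finset (Option V)).toList.map (Ctr.idx s)) v =
      (enum (idxBound n k) (Finset.univ : Finset (Option V)).toList (idxBound n k)).map
        fun g => setIdx s g v := by
    conv_lhs => rw [hv]
    exact enum_map_idx ..
  rw [hE] at h
  simp only [List.flatMap_map, List.forall_mem_map, setIdx, if_true] at h
  exact h fun g _ => hq w hw g

section

variable (H : SimpleGraph V) (lev : V → ℕ) (bit : ℕ → Bool)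

open Classical in
/-- The vertices of level `0` whose adjacency to `w` differs from the bit of the level of `w`. -/
noncomputable def attach (w : V) : List V :=
  (Finset.univ.filter fun u => lev u = 0 ∧ decide (H.Adj u w) ≠ bit (lev w)).toList

open Classical in
/-- The vertices of positive level. -/
noncomputable def upper : List V := (Finset.univ.filter fun w => 0 < lev w).toList

/-- Write the entry of the adjacency matrix for an old vertex and a copy of `w`. -/
noncomputable def entryOldNew (s : Bool) (w : V) : Cmd (Ctr V) :=
  anyEq (!bit (lev w)) (bit (lev w))
    ((attach H lev bit w).map fun u => (.old s, .idx (!s) (some u)))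

open Classical in
/-- Write the entry of the adjacency matrix for a copy of `w` and a copy of `w'`. -/
noncomputable def entryNewNew (w w' : V) : Cmd (Ctr V) :=
  allEq (decide (H.Adj w w')) (bit (max (lev w) (lev w')))
    ((Finset.univ : Finset (Option V)).toList.map fun i => (.idx false i, .idx true i))

/-- Write the adjacency matrix. -/
noncomputable def matrix : Cmd (Ctr V) :=
  forVertices false (upper lev)
    (forVertices true (upper lev) move (entryOldNew H lev bit false))
    fun w => forVertices true (upper lev) (entryOldNew H lev bit true w)
      (entryNewNew H lev bit w)

/-- The counter program for the reduction. -/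
noncomputable def reduction : Cmd (Ctr V) :=
  seq (.forAll (.old false) (.forAll (.old true) read)) <|
  seq (matrix H lev bit) <|
  seq (out false) <|
  seq (forVertices false (upper lev) (out true) fun _ => out true) <|
  seq (out false) (.forAll .k (out true))

end

end Cmd

namespace GraphInstance

open Classical in
/-- Adjacency of the vertices of an instance with given numbers. -/
noncomputable def adjNat (I : GraphInstance) (i j : ℕ) : Bool :=
  decide (∃ (hi : i < I.n) (hj : j < I.n), I.graph.Adj ⟨i, hi⟩ ⟨j, hj⟩)

theorem adjBits_eq (I : GraphInstance) : I.adjBits =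
    (List.range I.n).flatMap fun i => (List.range I.n).map fun j => I.adjNat i j := by
  simp only [adjBits, ← List.map_coe_finRange_eq_range, List.flatMap_map, List.map_map]
  refine List.flatMap_congr fun i _ => List.map_congr_left fun j _ => ?_
  simp [adjNat]

end GraphInstance

/-! ### The constructed instance and its computation in polynomial time. -/

section

variable (H : SimpleGraph V) (lev : V → ℕ) (bit : ℕ → Bool)

open Classical in
/-- Adjacency in the constructed graph. -/
noncomputable def rawAdj (I : GraphInstance) : RawVertex V → RawVertex V → Bool
  | .inl i, .inl j => I.adjNat i j
  | .inl j, .inr (w, g) =>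
    if ∃ u ∈ Cmd.attach H lev bit w, j = g (some u) then !bit (lev w) else bit (lev w)
  | .inr (w, g), .inl j =>
    if ∃ u ∈ Cmd.attach H lev bit w, j = g (some u) then !bit (lev w) else bit (lev w)
  | .inr (w, g), .inr (w', g') =>
    if g = g' then decide (H.Adj w w') else bit (max (lev w) (lev w'))

/-- The bit that is moved for a pair of vertices of the constructed graph. -/
noncomputable def rawMove (I : GraphInstance) : RawVertex V → RawVertex V → List Bool
  | .inl i, .inl j => [I.adjNat i j]
  | _, _ => []

-- A bit is moved exactly at pairs of old vertices. The double loop meets these in matrix order, so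
-- the moved bits together form the old matrix and the work stack ends up empty.
open Classical in
theorem emits_matrix (I : GraphInstance) :
    Cmd.Emits (ctrBound I.n I.k) (Cmd.matrix H lev bit) (ctrBound I.n I.k) I.adjBits
      ((rawVertices (Cmd.upper lev) I.n I.k).flatMap fun x =>
        (rawVertices (Cmd.upper lev) I.n I.k).map (rawAdj H lev bit I x)) := by
  have h : I.adjBits = (rawVertices (Cmd.upper lev) I.n I.k).flatMap fun x =>
      (rawVertices (Cmd.upper lev) I.n I.k).flatMap (rawMove I x) := by
    have hnil : ∀ {α : Type} (l : List α), l.flatMap (fun _ => ([] : List Bool)) = [] := by simp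
    simp only [rawVertices, rawMove, List.flatMap_append, List.flatMap_map, List.flatMap_assoc,
      hnil, List.append_nil]
    simp only [GraphInstance.adjBits_eq, List.map_eq_flatMap]
  have h' : ∀ x, (rawVertices (Cmd.upper lev) I.n I.k).map (rawAdj H lev bit I x) =
      (rawVertices (Cmd.upper lev) I.n I.k).flatMap fun y => [rawAdj H lev bit I x y] :=
    fun x => List.map_eq_flatMap ..
  have hne : ∀ (s : Bool) (w : V), ∀ x ∈ (Cmd.attach H lev bit w).map
      fun u => ((.old s : Ctr V), (.idx (!s) (some u) : Ctr V)), x.1 ≠ x.2 := by simp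
  rw [h]
  simp only [h']
  refine Cmd.emits_forVertices rfl (fun i => rfl) (fun i hi => ?_) (fun w hw g => ?_)
  · refine Cmd.emits_forVertices (by simp [ctrBound]) (fun i => by simp [ctrBound])
      (fun j hj => Cmd.emits_move _) (fun w hw g => ?_)
    simpa [rawMove, rawAdj, setIdx, Cmd.entryOldNew] using Cmd.emits_anyEq (B := ctrBound I.n I.k)
      (v := setIdx true g (Function.update (ctrBound I.n I.k) (.old false) i))
      (!bit (lev w)) (bit (lev w)) _ (hne false w)
  · refine Cmd.emits_forVertices (by simp [ctrBound, setIdx]) (fun i => by simp [ctrBound, setIdx])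
      (fun j hj => ?_) (fun w' hw' g' => ?_)
    · simpa [rawMove, rawAdj, setIdx, Cmd.entryOldNew] using Cmd.emits_anyEq (B := ctrBound I.n I.k)
        (v := Function.update (setIdx false g (ctrBound I.n I.k)) (.old true) j)
        (!bit (lev w)) (bit (lev w)) _ (hne true w)
    · simpa [rawMove, rawAdj, setIdx, Cmd.entryNewNew, funext_iff] using
        Cmd.emits_allEq (B := ctrBound I.n I.k)
        (v := setIdx true g' (setIdx false g (ctrBound I.n I.k)))
        (decide (H.Adj w w')) (bit (max (lev w) (lev w')))
        ((Finset.univ : Finset (Option V)).toList.map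
          fun i => ((.idx false i : Ctr V), (.idx true i : Ctr V))) (by simp)

theorem rawAdj_symm (I : GraphInstance) (x y : RawVertex V) :
    rawAdj H lev bit I x y = rawAdj H lev bit I y x := by
  rcases x with i | ⟨w, g⟩ <;> rcases y with j | ⟨w', g'⟩
  · simp only [rawAdj, GraphInstance.adjNat, decide_eq_decide]
    exact ⟨fun ⟨hi, hj, h⟩ => ⟨hj, hi, h.symm⟩, fun ⟨hi, hj, h⟩ => ⟨hj, hi, h.symm⟩⟩
  · rfl
  · rfl
  · simp only [rawAdj, max_comm (lev w) (lev w')]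
    by_cases h : g = g'
    · rw [if_pos h, if_pos h.symm, decide_eq_decide]
      exact H.adj_comm w w'
    · rw [if_neg h, if_neg (Ne.symm h)]

theorem rawAdj_self (I : GraphInstance) (x : RawVertex V) : rawAdj H lev bit I x x = false := by
  rcases x with i | ⟨w, g⟩ <;> simp [rawAdj, GraphInstance.adjNat]

/-- The instance that the reduction constructs. -/
noncomputable def reductionInstance (I : GraphInstance) : GraphInstance where
  n := (rawVertices (Cmd.upper lev) I.n I.k).length
  graph :=
    { Adj := fun p q => rawAdj H lev bit I (rawVertices (Cmd.upper lev) I.n I.k)[p]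
        (rawVertices (Cmd.upper lev) I.n I.k)[q]
      symm := ⟨fun p q h => by rwa [rawAdj_symm]⟩
      loopless := ⟨fun p h => by simp [rawAdj_self] at h⟩ }
  k := I.k

theorem adjBits_reductionInstance (I : GraphInstance) :
    (reductionInstance H lev bit I).adjBits = (rawVertices (Cmd.upper lev) I.n I.k).flatMap
      fun x => (rawVertices (Cmd.upper lev) I.n I.k).map (rawAdj H lev bit I x) := by
  have h : (List.finRange (rawVertices (Cmd.upper lev) I.n I.k).length).map
      (fun p => (rawVertices (Cmd.upper lev) I.n I.k)[p]) =
      rawVertices (Cmd.upper lev) I.n I.k := by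
    refine List.ext_getElem (by simp) fun i _ _ => by simp
  conv_rhs => rw [← h]
  simp only [GraphInstance.adjBits, reductionInstance, List.flatMap_map, List.map_map]
  refine List.flatMap_congr fun i _ => List.map_congr_left fun j _ => ?_
  exact Bool.eq_iff_iff.2 (@decide_eq_true_iff _ (Classical.propDecidable _))

theorem length_adjBits (I : GraphInstance) : I.adjBits.length = I.n * I.n := by
  simp [GraphInstance.adjBits, List.length_flatMap]

/-- The encoding is built from its end: the matrix, then the number of vertices in unary, then the
parameter. The initial reading loops reverse the old matrix, so that its last bit is available
first. -/
theorem den_reduction (I : GraphInstance) :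
    (Cmd.reduction H lev bit).OK (ctrBound I.n I.k) (ctrBound I.n I.k) ∧
    (Cmd.reduction H lev bit).den (ctrBound I.n I.k) (ctrBound I.n I.k) ⟨I.adjBits, [], []⟩ =
      ⟨[], [], (reductionInstance H lev bit I).encode⟩ := by
  have h₁ := emits_matrix H lev bit I
  have h₂ : Cmd.Emits (ctrBound I.n I.k) (Cmd.forVertices false (Cmd.upper lev) (.out true)
      fun _ => .out true) (ctrBound I.n I.k) ((rawVertices (Cmd.upper lev) I.n I.k).flatMap
      fun _ => []) ((rawVertices (Cmd.upper lev) I.n I.k).flatMap fun _ => [true]) :=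
    Cmd.emits_forVertices rfl (fun i => rfl) (fun _ _ => Cmd.emits_out _)
      (fun _ _ _ => Cmd.emits_out _)
  have h₃ : Cmd.Emits (ctrBound I.n I.k) (.forAll .k (.out true)) (ctrBound (V := V) I.n I.k)
      ((List.range I.k).flatMap fun _ => []) ((List.range I.k).flatMap fun _ => [true]) :=
    Cmd.emits_for rfl fun _ _ => Cmd.emits_out _
  have hnil : ∀ {α : Type} (l : List α), l.flatMap (fun _ => ([] : List Bool)) = [] := by simp
  have htrue : ∀ {α : Type} (l : List α), l.flatMap (fun _ => [true]) =
      List.replicate l.length true := fun l => by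
    rw [← List.map_eq_flatMap, List.map_const']
  have h := h₁.seq ((Cmd.emits_out false).seq (h₂.seq ((Cmd.emits_out false).seq h₃)))
  refine ⟨⟨⟨rfl, fun j _ => ⟨by simp, fun _ _ => trivial⟩⟩, h.1⟩, ?_⟩
  have h' := h.2 [] [] []
  have hr := Cmd.den_for_for_read (B := ctrBound (V := V) I.n I.k) (v := ctrBound I.n I.k)
    (c := .old false) (c' := .old true) (r := []) (o := []) rfl rfl _ (length_adjBits I)
  rw [Cmd.reduction, Cmd.den, hr]
  simp only [hnil, htrue, List.nil_append, List.append_nil, List.length_range] at h' ⊢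
  rw [h', ← adjBits_reductionInstance, GraphInstance.encode_eq]
  simp [reductionInstance]

/-- The reduction is computable in polynomial time. -/
theorem nonempty_tm2ComputableInPolyTime_reductionInstance :
    Nonempty (Turing.TM2ComputableInPolyTime GraphInstance.encode GraphInstance.encode
      (reductionInstance H lev bit)) := by
  -- The counters for the tag `none` receive `k` through `ks` and one more through `ks'`, which
  -- gives `k + 1` tags; all counters outside `ks` receive `n`.
  let ks : List (Ctr V) := [.k, .idx false none, .idx true none]
  let ks' : List (Ctr V) := [.idx false none, .idx true none]
  let ns : List (Ctr V) := (Finset.univ.filter fun c : Ctr V => c ∉ ks).toList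
  have hB : ∀ I, counterBound ks ks' ns I = ctrBound I.n I.k := by
    intro I
    funext c
    have hk : ∀ c ∈ ks, ns.count c = 0 := fun c hc => List.count_eq_zero.2 (by simp [ns, hc])
    have hn : ∀ c ∉ ks, ns.count c = 1 := fun c hc =>
      List.count_eq_one_of_mem (Finset.nodup_toList _) (by simp [ns, hc])
    rcases c with _ | s | ⟨_ | _, _ | u⟩
    · simp [counterBound, hk, ks, ks', ctrBound]
    · rw [counterBound, hn _ (by simp [ks])]
      simp [ks, ks', ctrBound]
    · simp [counterBound, hk, ks, ks', ctrBound, idxBound]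
    · rw [counterBound, hn _ (by simp [ks])]
      simp [ks, ks', ctrBound, idxBound]
    · simp [counterBound, hk, ks, ks', ctrBound, idxBound]
    · rw [counterBound, hn _ (by simp [ks])]
      simp [ks, ks', ctrBound, idxBound]
  refine nonempty_tm2ComputableInPolyTime_of_cmd (Cmd.reduction H lev bit) ks ks' ns ?_ ?_
  · intro I
    rw [hB]
    exact (den_reduction H lev bit I).1
  · intro I
    rw [hB]
    exact (den_reduction H lev bit I).2

end

end Reduction

/-! ### Peelings -/

open Classical in
/-- The vertices `x ≠ v` of level at most `L` for which the adjacency of `v` and `x` differs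
from `b`. -/
noncomputable def diffNeighbors {V : Type u} [Fintype V] (H : SimpleGraph V) (lev : V → ℕ)
    (b : Bool) (L : ℕ) (v : V) : Finset V :=
  Finset.univ.filter fun x => x ≠ v ∧ lev x ≤ L ∧ decide (H.Adj v x) ≠ b

/-- A function `lev` is a peeling if for every `L > 0` the vertices of level `L` have, in the graph
induced by the vertices of level at most `L`, smaller degrees than all vertices of lower level
(if `bit L = false`), or smaller degrees in the complement (if `bit L = true`). -/
def IsPeeling {V : Type u} [Fintype V] (H : SimpleGraph V) (lev : V → ℕ) (bit : ℕ → Bool) : Prop :=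
  ∀ u w, lev u < lev w → (diffNeighbors H lev (bit (lev w)) (lev w) w).card <
    (diffNeighbors H lev (bit (lev w)) (lev w) u).card

/-! ### Correctness of the reduction -/

theorem mem_enum {D : Type} [DecidableEq D] {B : D → ℕ} {cs : List D} {v g : D → ℕ} :
    g ∈ enum B cs v ↔ (∀ c ∈ cs, g c < B c) ∧ ∀ c ∉ cs, g c = v c := by
  induction cs generalizing v with
  | nil => simp [enum, funext_iff]
  | cons c cs ih =>
    simp only [enum, List.mem_flatMap, List.mem_range, ih]
    constructor
    · rintro ⟨j, hj, h₁, h₂⟩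
      refine ⟨fun c' hc' => ?_, fun c' hc' => ?_⟩
      · by_cases h : c' ∈ cs
        · exact h₁ c' h
        · obtain rfl : c' = c := by simpa [h] using hc'
          rw [h₂ c' h, Function.update_self]
          exact hj
      · simp only [List.mem_cons, not_or] at hc'
        rw [h₂ c' hc'.2, Function.update_of_ne hc'.1]
    · rintro ⟨h₁, h₂⟩
      refine ⟨g c, h₁ c List.mem_cons_self, fun c' hc' => h₁ c' (List.mem_cons_of_mem _ hc'),
        fun c' hc' => ?_⟩
      by_cases h : c' = c
      · rw [h, Function.update_self]
      · rw [Function.update_of_ne h, h₂ c' (by simp [h, hc'])]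

theorem nodup_enum {D : Type} [DecidableEq D] {B : D → ℕ} {cs : List D} {v : D → ℕ}
    (h : cs.Nodup) : (enum B cs v).Nodup := by
  induction cs generalizing v with
  | nil => simp [enum]
  | cons c cs ih =>
    rw [List.nodup_cons] at h
    refine List.nodup_flatMap.2 ⟨fun j _ => ih h.2, ?_⟩
    refine List.Nodup.pairwise_of_forall_ne List.nodup_range fun i _ j _ hij => ?_
    intro g hg hg'
    have h₁ := (mem_enum.1 hg).2 c h.1
    have h₂ := (mem_enum.1 hg').2 c h.1
    rw [Function.update_self] at h₁ h₂
    exact hij (h₁.symm.trans h₂)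

section

variable {V : Type} [Fintype V] [DecidableEq V]

theorem inl_mem_rawVertices {W : List V} {n k j : ℕ} : Sum.inl j ∈ rawVertices W n k ↔ j < n := by
  simp [rawVertices]

theorem inr_mem_rawVertices {W : List V} {n k : ℕ} {w : V} {g : Option V → ℕ} :
    Sum.inr (w, g) ∈ rawVertices W n k ↔ w ∈ W ∧ ∀ i, g i < idxBound n k i := by
  simp [rawVertices, mem_enum]

theorem nodup_rawVertices {W : List V} (hW : W.Nodup) (n k : ℕ) : (rawVertices W n k).Nodup := by
  refine List.Nodup.append (List.nodup_range.map Sum.inl_injective)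
    (List.nodup_flatMap.2 ⟨fun w _ => ?_, ?_⟩) ?_
  · exact (nodup_enum (Finset.nodup_toList _)).map fun g g' h => by simpa using h
  · refine List.Nodup.pairwise_of_forall_ne hW fun i _ j _ hij => ?_
    intro x hx hx'
    simp only [List.mem_map] at hx hx'
    obtain ⟨g, _, rfl⟩ := hx
    obtain ⟨g', _, h⟩ := hx'
    simp only [Sum.inr.injEq, Prod.mk.injEq] at h
    exact hij h.1.symm
  · intro x hx hx'
    simp only [List.mem_map, List.mem_flatMap] at hx hx'
    obtain ⟨j, _, rfl⟩ := hx
    obtain ⟨_, _, _, _, h⟩ := hx'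
    cases h

variable (H : SimpleGraph V) (lev : V → ℕ) (bit : ℕ → Bool)

theorem mem_upper {w : V} : w ∈ Cmd.upper lev ↔ 0 < lev w := by simp [Cmd.upper]

open Classical in
theorem mem_attach {u w : V} :
    u ∈ Cmd.attach H lev bit w ↔ lev u = 0 ∧ decide (H.Adj u w) ≠ bit (lev w) := by
  simp [Cmd.attach]

/-- The vertex that represents `u` in the copy of `H` with index `g`. -/
def copyVertex (g : Option V → ℕ) (u : V) : RawVertex V :=
  if lev u = 0 then .inl (g (some u)) else .inr (u, g)

-- Injectivity of `g` on level 0 gives an old vertex only one role in the copy, so this role alone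
-- decides whether the default is flipped. Pairs within level 0 are excluded because their adjacency
-- comes from the instance.
open Classical in
theorem rawAdj_copyVertex (I : GraphInstance) {g : Option V → ℕ}
    (hg : ∀ u u', lev u = 0 → lev u' = 0 → g (some u) = g (some u') → u = u') {a b : V}
    (hab : ¬ (lev a = 0 ∧ lev b = 0)) :
    rawAdj H lev bit I (copyVertex lev g a) (copyVertex lev g b) = true ↔ H.Adj a b := by
  have key : ∀ a b, lev a = 0 → lev b ≠ 0 →
      (rawAdj H lev bit I (copyVertex lev g a) (copyVertex lev g b) = true ↔ H.Adj a b) := by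
    intro a b ha hb
    simp only [copyVertex, ha, hb, if_true, if_false, rawAdj]
    have h : (∃ u ∈ Cmd.attach H lev bit b, g (some a) = g (some u)) ↔
        decide (H.Adj a b) ≠ bit (lev b) := by
      constructor
      · rintro ⟨u, hu, h⟩
        rw [mem_attach] at hu
        rw [hg a u ha hu.1 h]
        exact hu.2
      · exact fun h => ⟨a, (mem_attach H lev bit).2 ⟨ha, h⟩, rfl⟩
    rw [if_congr h rfl rfl]
    by_cases h' : H.Adj a b <;> cases bit (lev b) <;> simp [h']
  by_cases ha : lev a = 0
  · exact key a b ha fun hb => hab ⟨ha, hb⟩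
  · by_cases hb : lev b = 0
    · rw [rawAdj_symm, key b a hb ha, H.adj_comm]
    · simp [copyVertex, ha, hb, rawAdj]

/-- The level of a vertex of the constructed graph. -/
def rawLevel : RawVertex V → ℕ
  | .inl _ => 0
  | .inr (w, _) => lev w

-- Towards levels up to its own, a new vertex deviates from its default only inside its own copy.
-- Hence it has no more deviations than `w` has in `H`. This needs no injectivity of `g`.
open Classical in
theorem exists_eq_copyVertex (I : GraphInstance) {w : V} {g : Option V → ℕ} {x : RawVertex V}
    (hw : 0 < lev w) (hx : rawLevel lev x ≤ lev w) (hne : x ≠ .inr (w, g))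
    (hpos : ∀ w' g', x = .inr (w', g') → 0 < lev w')
    (hadj : rawAdj H lev bit I (.inr (w, g)) x ≠ bit (lev w)) :
    ∃ y ∈ diffNeighbors H lev (bit (lev w)) (lev w) w, x = copyVertex lev g y := by
  rcases x with j | ⟨w', g'⟩
  · simp only [rawAdj] at hadj
    split_ifs at hadj with h
    · obtain ⟨u, hu, rfl⟩ := h
      rw [mem_attach] at hu
      refine ⟨u, ?_, by simp [copyVertex, hu.1]⟩
      simp only [diffNeighbors, Finset.mem_filter, Finset.mem_univ, true_and]
      refine ⟨fun h => ?_, hu.1 ▸ Nat.zero_le _, ?_⟩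
      · rw [h] at hu
        omega
      · simpa only [H.adj_comm] using hu.2
    · exact absurd rfl hadj
  · simp only [rawAdj] at hadj
    simp only [rawLevel] at hx
    have hw' := hpos w' g' rfl
    split_ifs at hadj with h
    · subst h
      refine ⟨w', ?_, by simp [copyVertex, hw'.ne']⟩
      simp only [diffNeighbors, Finset.mem_filter, Finset.mem_univ, true_and]
      exact ⟨fun h => hne (by rw [h]), hx, hadj⟩
    · rw [max_eq_left hx] at hadj
      exact absurd rfl hadj

variable {H lev bit}

theorem deleteEdges_adj_of_new {N : ℕ} {I : GraphInstance} {G : SimpleGraph (Fin N)}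
    {old : Fin I.n → Fin N} {F : Finset (Sym2 (Fin I.n))} {p q : Fin N} (hp : ∀ i, old i ≠ p) :
    (G.deleteEdges ((F.image (Sym2.map old) : Finset _) : Set (Sym2 (Fin N)))).Adj p q ↔
      G.Adj p q := by
  rw [SimpleGraph.deleteEdges_adj, and_iff_left_iff_imp]
  intro _ h
  simp only [Finset.coe_image, Set.mem_image] at h
  obtain ⟨e, _, he⟩ := h
  have : p ∈ Sym2.map old e := he ▸ Sym2.mem_mk_left p q
  obtain ⟨i, _, hi⟩ := Sym2.mem_map.1 this
  exact hp i hi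

/-- The peeling inequality prevents a vertex of `H` from being mapped to a higher level. So level 0
lands on old vertices, where the constructed graph agrees with the instance. -/
theorem isIndContained_of_isIndContained_deleteEdges (hlev : IsPeeling H lev bit) {N : ℕ}
    {I : GraphInstance} {G : SimpleGraph (Fin N)} {r : Fin N → RawVertex V}
    (hr : Function.Injective r) (hpos : ∀ p w g, r p = .inr (w, g) → 0 < lev w)
    (hadj : ∀ p q, G.Adj p q ↔ rawAdj H lev bit I (r p) (r q) = true) {old : Fin I.n → Fin N}
    (hold : ∀ i, r (old i) = .inl i) (hlt : ∀ p j, r p = .inl j → j < I.n)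
    {F : Finset (Sym2 (Fin I.n))}
    (h : H.IsIndContained
      (G.deleteEdges ((F.image (Sym2.map old) : Finset _) : Set (Sym2 (Fin N))))) :
    (H.induce {u | lev u = 0}).IsIndContained
      (I.graph.deleteEdges (F : Set (Sym2 (Fin I.n)))) := by
  classical
  obtain ⟨φ⟩ := h
  -- Descending induction on the level `L`, with `d` the distance to the top level.
  have key : ∀ d L, L + d = Finset.univ.sup lev → ∀ u, lev u ≤ L →
      rawLevel lev (r (φ u)) ≤ L := by
    intro d
    induction d with
    | zero =>
      intro L hL u _
      rw [add_zero] at hL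
      rcases h : r (φ u) with j | ⟨w, g⟩
      · exact Nat.zero_le _
      · rw [hL]
        exact Finset.le_sup (f := lev) (Finset.mem_univ w)
    | succ d ih =>
      intro L hL u hu
      have ih := ih (L + 1) (by omega)
      by_contra hlt
      have hL1 := ih u (by omega)
      rcases h : r (φ u) with j | ⟨w, g⟩
      · rw [h] at hlt
        exact hlt (Nat.zero_le _)
      · rw [h] at hlt hL1
        simp only [rawLevel] at hlt hL1
        have hw : lev w = L + 1 := by omega
        -- If `u`, of level at most `L`, were mapped to a copy of `w` of level `L + 1`, the
        -- deviations of `u` would embed into those of `w`, contrary to the peeling inequality.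
        have hsub : (diffNeighbors H lev (bit (lev w)) (lev w) u).image (fun x => r (φ x)) ⊆
            (diffNeighbors H lev (bit (lev w)) (lev w) w).image (copyVertex lev g) := by
          intro z hz
          obtain ⟨x, hx, rfl⟩ := Finset.mem_image.1 hz
          simp only [diffNeighbors, Finset.mem_filter, Finset.mem_univ, true_and] at hx
          obtain ⟨y, hy, hxy⟩ := exists_eq_copyVertex H lev bit I (w := w) (g := g)
            (x := r (φ x)) (by omega) (hw ▸ ih x (hw ▸ hx.2.1))
            (fun hne => hx.1 (φ.injective (hr (hne.trans h.symm)))) (hpos (φ x)) (by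
              rw [← h]
              -- Only edges between old vertices are deleted, so the adjacencies at this new vertex
              -- are intact.
              have h₁ : H.Adj u x ↔ rawAdj H lev bit I (r (φ u)) (r (φ x)) = true := by
                rw [← hadj, ← φ.map_adj_iff]
                refine deleteEdges_adj_of_new fun i hi => ?_
                rw [← hi, hold] at h
                cases h
              rw [show rawAdj H lev bit I (r (φ u)) (r (φ x)) = decide (H.Adj u x) from
                Bool.eq_iff_iff.2 (h₁.symm.trans decide_eq_true_iff.symm)]
              simpa using hx.2.2)
          exact Finset.mem_image.2 ⟨y, hy, hxy.symm⟩
        have hcard := Finset.card_le_card hsub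
        rw [Finset.card_image_of_injective _
          (show Function.Injective fun x => r (φ x) from hr.comp φ.injective)] at hcard
        exact absurd (hlev u w (by omega)) (hcard.trans Finset.card_image_le).not_gt
  have hzero : ∀ u, lev u = 0 → ∃ i, φ u = old i := by
    intro u hu
    have h0 := key _ 0 (zero_add _) u hu.le
    rcases h : r (φ u) with j | ⟨w, g⟩
    · exact ⟨⟨j, hlt _ _ h⟩, hr (by rw [h, hold])⟩
    · rw [h] at h0
      have := hpos _ _ _ h
      simp only [rawLevel] at h0
      omega
  have holdinj : Function.Injective old := fun i j hij => by
    have := (hold i).symm.trans ((congrArg r hij).trans (hold j))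
    simpa [Fin.ext_iff] using this
  choose ψ hψ using fun u : {u | lev u = 0} => hzero u.1 u.2
  refine ⟨⟨⟨ψ, fun a b hab => ?_⟩, fun {a b} => ?_⟩⟩
  · exact Subtype.ext (φ.injective (by rw [hψ, hψ, hab]))
  · rw [SimpleGraph.comap_adj]
    refine Iff.trans ?_ φ.map_adj_iff
    change (I.graph.deleteEdges _).Adj (ψ a) (ψ b) ↔ (G.deleteEdges _).Adj (φ a) (φ b)
    rw [hψ a, hψ b, SimpleGraph.deleteEdges_adj, SimpleGraph.deleteEdges_adj, hadj, hold, hold]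
    refine and_congr (by simp [rawAdj, GraphInstance.adjNat]) (not_congr ?_)
    rw [show s(old (ψ a), old (ψ b)) = Sym2.map old s(ψ a, ψ b) from rfl, Finset.mem_coe,
      Finset.mem_coe, (Sym2.map.injective holdinj).mem_finset_image]

/-- A surviving induced subgraph on level 0 extends to `k + 1` copies of `H` that share only old
vertices. Each must lose an edge at one of its new vertices, and these edges are distinct. -/
theorem not_isIndContained_of_not_isIndContained (h0 : ∃ u, lev u = 0) {N : ℕ}
    {I : GraphInstance} {G : SimpleGraph (Fin N)} {r : Fin N → RawVertex V}
    (hr : Function.Injective r)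
    (hmem : ∀ w g, 0 < lev w → (∀ i, g i < idxBound I.n I.k i) → ∃ p, r p = .inr (w, g))
    (hadj : ∀ p q, G.Adj p q ↔ rawAdj H lev bit I (r p) (r q) = true) {old : Fin I.n → Fin N}
    (hold : ∀ i, r (old i) = .inl i) {F : Finset (Sym2 (Fin N))} (hF : F.card ≤ I.k)
    (h : ¬ H.IsIndContained (G.deleteEdges (F : Set (Sym2 (Fin N))))) :
    ¬ (H.induce {u | lev u = 0}).IsIndContained
      (I.graph.deleteEdges {e | Sym2.map old e ∈ F}) := by
  classical
  rintro ⟨ψ⟩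
  obtain ⟨u₀, hu₀⟩ := h0
  -- The tag separates the copies. Values at vertices of positive level are irrelevant and only have
  -- to be in range, which the image of `u₀` ensures.
  let g : Fin (I.k + 1) → Option V → ℕ := fun i o => match o with
    | none => i
    | some u => if hu : lev u = 0 then (ψ ⟨u, hu⟩ : ℕ) else (ψ ⟨u₀, hu₀⟩ : ℕ)
  have hg0 : ∀ i u (hu : lev u = 0), g i (some u) = ψ ⟨u, hu⟩ := fun i u hu => by simp [g, hu]
  have hg : ∀ i o, g i o < idxBound I.n I.k o := by
    intro i o
    rcases o with _ | u
    · exact i.2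
    · simp only [g, idxBound]
      split_ifs <;> exact Fin.is_lt _
  have hginj : ∀ i u u', lev u = 0 → lev u' = 0 → g i (some u) = g i (some u') → u = u' := by
    intro i u u' hu hu' h
    rw [hg0 i u hu, hg0 i u' hu'] at h
    simpa using ψ.injective (Fin.ext h)
  have hgi : ∀ i j, g i = g j → i = j := fun i j h => Fin.ext (congrFun h none)
  have hcopy : ∀ i u, ∃ p, r p = copyVertex lev (g i) u := by
    intro i u
    by_cases hu : lev u = 0
    · exact ⟨old (ψ ⟨u, hu⟩), by simp [hold, copyVertex, hu, hg0]⟩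
    · simp only [copyVertex, hu, if_false]
      exact hmem u (g i) (Nat.pos_of_ne_zero hu) (hg i)
  choose c hc using hcopy
  have hcold : ∀ i u (hu : lev u = 0), c i u = old (ψ ⟨u, hu⟩) := fun i u hu =>
    hr (by simp [hc, hold, copyVertex, hu, hg0])
  have hcinj : ∀ i, Function.Injective (c i) := by
    intro i u u' h
    have h := (hc i u).symm.trans ((congrArg r h).trans (hc i u'))
    simp only [copyVertex] at h
    split_ifs at h with hu hu'
    · exact hginj i u u' hu hu' (Sum.inl_injective h)
    · simpa using congrArg Prod.fst (Sum.inr_injective h)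
  -- Otherwise copy `i` would be untouched outside level 0, while `ψ` supplies the right adjacencies
  -- on level 0.
  have hex : ∀ i, ∃ a b, lev a ≠ 0 ∧ s(c i a, c i b) ∈ F := by
    intro i
    by_contra! hno
    refine h ⟨⟨⟨c i, hcinj i⟩, fun {a b} => ?_⟩⟩
    rw [Function.Embedding.coeFn_mk, SimpleGraph.deleteEdges_adj, Finset.mem_coe]
    by_cases hab : lev a = 0 ∧ lev b = 0
    · have := ψ.map_adj_iff (v := ⟨a, hab.1⟩) (w := ⟨b, hab.2⟩)
      rw [SimpleGraph.comap_adj, SimpleGraph.deleteEdges_adj] at this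
      simp only [Function.Embedding.subtype_apply, Set.mem_ofPred_eq, Sym2.map_mk] at this
      rw [← this, hadj, hcold i a hab.1, hcold i b hab.2, hold, hold]
      exact and_congr (by simp [rawAdj, GraphInstance.adjNat]) Iff.rfl
    · rw [hadj, hc, hc, rawAdj_copyVertex H lev bit I (hginj i) hab, and_iff_left]
      by_cases ha : lev a = 0
      · rw [Sym2.eq_swap]
        exact hno b a fun hb => hab ⟨ha, hb⟩
      · exact hno a b ha
  choose a b ha hab using hex
  -- The new endpoint of the deleted edge carries the index function of its copy, from which the tag
  -- is recovered.
  have hinj : Function.Injective fun i => (⟨s(c i (a i), c i (b i)), hab i⟩ : F) := by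
    intro i j hij
    have hij : s(c i (a i), c i (b i)) = s(c j (a j), c j (b j)) := Subtype.ext_iff.1 hij
    have hmem : c i (a i) ∈ s(c j (a j), c j (b j)) := hij ▸ Sym2.mem_mk_left _ _
    have : ∀ u, c i (a i) = c j u → i = j := by
      intro u hu
      have h := (hc i (a i)).symm.trans ((congrArg r hu).trans (hc j u))
      simp only [copyVertex, ha i, if_false] at h
      split_ifs at h
      exact hgi i j (congrArg Prod.snd (Sum.inr_injective h))
    rcases Sym2.mem_iff.1 hmem with h | h
    · exact this _ h
    · exact this _ h
  have := Fintype.card_le_of_injective _ hinj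
  simp only [Fintype.card_fin, Fintype.card_coe] at this
  omega

/-- The reduction preserves and reflects yes-instances. -/
theorem mem_freeEdgeDeletion_iff (hlev : IsPeeling H lev bit) (h0 : ∃ u, lev u = 0)
    (I : GraphInstance) : I ∈ freeEdgeDeletion (H.induce {u | lev u = 0}) ↔
      reductionInstance H lev bit I ∈ freeEdgeDeletion H := by
  classical
  set R := rawVertices (Cmd.upper lev) I.n I.k with hR
  let r : Fin (reductionInstance H lev bit I).n → RawVertex V := fun p => R.get p
  have hr : Function.Injective r :=
    List.nodup_iff_injective_get.1 (nodup_rawVertices (Finset.nodup_toList _) _ _)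
  have hmemR : ∀ p, r p ∈ R := fun p => List.get_mem R p
  have hsurj : ∀ x ∈ R, ∃ p, r p = x := fun x hx => List.mem_iff_get.1 hx
  have hadj : ∀ p q, (reductionInstance H lev bit I).graph.Adj p q ↔
      rawAdj H lev bit I (r p) (r q) = true := fun p q => Iff.rfl
  choose old hold using fun i : Fin I.n => hsurj (.inl i) (inl_mem_rawVertices.2 i.2)
  have holdinj : Function.Injective old := fun i j hij => by
    have := (hold i).symm.trans ((congrArg r hij).trans (hold j))
    simpa [Fin.ext_iff] using this
  have hpos : ∀ p w g, r p = .inr (w, g) → 0 < lev w := fun p w g h =>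
    (mem_upper lev).1 (inr_mem_rawVertices.1 (h ▸ hmemR p)).1
  have hlt : ∀ p j, r p = .inl j → j < I.n := fun p j h =>
    inl_mem_rawVertices.1 (h ▸ hmemR p)
  have hadj' : ∀ i j, (reductionInstance H lev bit I).graph.Adj (old i) (old j) ↔
      I.graph.Adj i j := fun i j => by
    rw [hadj, hold, hold]
    simp [rawAdj, GraphInstance.adjNat]
  constructor
  · rintro ⟨F, hFG, hFk, hF⟩
    refine ⟨F.image (Sym2.map old), ?_, Finset.card_image_le.trans hFk, fun h =>
      hF (isIndContained_of_isIndContained_deleteEdges hlev hr hpos hadj hold hlt h)⟩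
    intro e he
    rw [Finset.coe_image] at he
    obtain ⟨e, he, rfl⟩ := he
    have := hFG he
    induction e with
    | _ i j => exact (hadj' i j).2 this
  · rintro ⟨F, hFG, hFk, hF⟩
    refine ⟨Finset.univ.filter fun e => Sym2.map old e ∈ F, ?_, le_trans ?_ hFk, ?_⟩
    · intro e he
      have he : Sym2.map old e ∈ F := by simpa using he
      have := hFG he
      induction e with
      | _ i j => exact (hadj' i j).1 this
    · refine Finset.card_le_card_of_injOn (Sym2.map old) (fun e he => by simpa using he)
        (Sym2.map.injective holdinj).injOn
    · rw [Finset.coe_filter]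
      simp only [Finset.mem_univ, true_and]
      exact not_isIndContained_of_not_isIndContained h0 hr
        (fun w g hw hg => hsurj _ (inr_mem_rawVertices.2 ⟨(mem_upper lev).2 hw, hg⟩))
        hadj hold hFk hF

end

/-! ### The reduction for an arbitrary peeling -/

section Transport

variable {V : Type u} [Fintype V]

theorem freeEdgeDeletion_congr {W : Type} {H : SimpleGraph V} {H' : SimpleGraph W} (e : H ≃g H') :
    freeEdgeDeletion H = freeEdgeDeletion H' := by
  have h : ∀ {X : Type} (G : SimpleGraph X), H.IsIndContained G ↔ H'.IsIndContained G := fun G =>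
    ⟨fun ⟨φ⟩ => ⟨φ.comp e.symm.toEmbedding⟩, fun ⟨φ⟩ => ⟨φ.comp e.toEmbedding⟩⟩
  simp only [freeEdgeDeletion, h]

theorem IsPeeling.comap_equiv {W : Type} [Fintype W] {H : SimpleGraph V} {lev : V → ℕ}
    {bit : ℕ → Bool} (h : IsPeeling H lev bit) (e : W ≃ V) :
    IsPeeling (H.comap e) (lev ∘ e) bit := by
  classical
  have key : ∀ b L w, (diffNeighbors (H.comap e) (lev ∘ e) b L w).card =
      (diffNeighbors H lev b L (e w)).card := by
    intro b L w
    refine Finset.card_equiv e fun x => ?_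
    simp [diffNeighbors]
  intro u w huw
  rw [key, key]
  exact h _ _ huw

theorem IsPeeling.linearParamReducible {H : SimpleGraph V} {lev : V → ℕ} {bit : ℕ → Bool}
    (h : IsPeeling H lev bit) (h0 : ∃ u, lev u = 0) :
    LinearParamReducible (freeEdgeDeletion (H.induce {u | lev u = 0})) (freeEdgeDeletion H) := by
  classical
  -- The vertices of `H` may live in any universe, whereas the machine construction needs a type in
  -- `Type`.
  let e : Fin (Fintype.card V) ≃ V := (Fintype.equivFin V).symm
  let f : H.comap e ≃g H := SimpleGraph.Iso.comap e H
  have f' : (H.comap e).induce {u | (lev ∘ e) u = 0} ≃g H.induce {u | lev u = 0} :=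
    ⟨e.subtypeEquiv fun _ => Iff.rfl, Iff.rfl⟩
  rw [freeEdgeDeletion_congr f.symm, freeEdgeDeletion_congr f'.symm]
  refine ⟨reductionInstance (H.comap e) (lev ∘ e) bit,
    nonempty_tm2ComputableInPolyTime_reductionInstance _ _ _,
    mem_freeEdgeDeletion_iff (h.comap_equiv e) ?_, 1, fun I => (one_mul _).ge⟩
  obtain ⟨u, hu⟩ := h0
  exact ⟨e.symm u, by simpa using hu⟩

end Transport

/-! ### Deletion-Churn yields a peeling -/

section Peeling

variable {V : Type u} [Fintype V]

-- The vertices outside `S` form a new top level `M`. Conditions at lower levels ignore that level,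
-- and at level `M` the deviations are counted over the whole graph, as in `hS`.
open Classical in
theorem IsPeeling.extend {H : SimpleGraph V} (S : Finset V) [Fintype (S : Set V)] (b : Bool)
    (hS : ∀ u ∈ S, ∀ w ∉ S, (Finset.univ.filter fun x => x ≠ w ∧ decide (H.Adj w x) ≠ b).card <
      (Finset.univ.filter fun x => x ≠ u ∧ decide (H.Adj u x) ≠ b).card)
    {lev : ↥(S : Set V) → ℕ} {bit : ℕ → Bool} (h : IsPeeling (H.induce (S : Set V)) lev bit) :
    ∃ lev' bit', IsPeeling H lev' bit' ∧
      ∀ u, lev' u = 0 ↔ ∃ hu : u ∈ (S : Set V), lev ⟨u, hu⟩ = 0 := by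
  -- The added one puts `M` above all old levels and keeps it positive, so that level 0 stays inside
  -- `S`.
  set M := Finset.univ.sup lev + 1
  have hM : ∀ u, lev u < M := fun u => Nat.lt_succ_of_le (Finset.le_sup (Finset.mem_univ u))
  let lev' : V → ℕ := fun u => if hu : u ∈ (S : Set V) then lev ⟨u, hu⟩ else M
  let bit' : ℕ → Bool := fun L => if L < M then bit L else b
  have hin : ∀ u : (S : Set V), lev' u = lev u := fun u => dif_pos u.2
  have hout : ∀ u, u ∉ S → lev' u = M := fun u hu => dif_neg hu
  have hle : ∀ u, lev' u ≤ M := fun u => by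
    by_cases hu : u ∈ S
    · exact (hin ⟨u, hu⟩).trans_le (hM _).le
    · exact (hout u hu).le
  refine ⟨lev', bit', fun u w huw => ?_, fun u => ?_⟩
  · by_cases hw : w ∈ S
    · lift w to (S : Set V) using hw
      rw [hin] at huw ⊢
      have hu : u ∈ S := by
        by_contra hu
        rw [hout u hu] at huw
        exact (hM w).not_gt huw
      lift u to (S : Set V) using hu
      rw [hin] at huw
      have key : ∀ c L, L < M → ∀ v : (S : Set V), (diffNeighbors H lev' c L v).card =
          (diffNeighbors (H.induce (S : Set V)) lev c L v).card := by
        intro c L hL v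
        rw [← Finset.card_map (Function.Embedding.subtype _)]
        congr 1
        ext x
        simp only [diffNeighbors, Finset.mem_filter, Finset.mem_univ, true_and, Finset.mem_map,
          Function.Embedding.subtype_apply]
        constructor
        · rintro ⟨h₁, h₂, h₃⟩
          have hx : x ∈ S := by
            by_contra hx
            rw [hout x hx] at h₂
            omega
          refine ⟨⟨x, hx⟩, ⟨fun h => h₁ (congrArg Subtype.val h), ?_, by simpa using h₃⟩, rfl⟩
          rwa [← hin]
        · rintro ⟨x, ⟨h₁, h₂, h₃⟩, rfl⟩
          exact ⟨fun h => h₁ (Subtype.ext h), by rwa [hin], by simpa using h₃⟩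
      rw [key _ _ (hM w), key _ _ (hM w), show bit' (lev w) = bit (lev w) from if_pos (hM w)]
      exact h u w huw
    · rw [hout w hw] at huw ⊢
      have hu : u ∈ S := by
        by_contra hu
        rw [hout u hu] at huw
        exact lt_irrefl _ huw
      rw [show bit' M = b from if_neg (lt_irrefl M)]
      have key : ∀ v, diffNeighbors H lev' b M v =
          Finset.univ.filter fun x => x ≠ v ∧ decide (H.Adj v x) ≠ b := by
        intro v
        ext x
        simp [diffNeighbors, hle x]
      rw [key, key]
      exact hS u hu w hw
  · by_cases hu : u ∈ S
    · rw [show lev' u = lev ⟨u, hu⟩ from dif_pos hu]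
      exact ⟨fun h => ⟨hu, h⟩, fun ⟨_, h⟩ => h⟩
    · rw [hout u hu]
      exact ⟨fun h => by omega, fun ⟨h, _⟩ => absurd h hu⟩

open Classical in
theorem card_filter_adj (H : SimpleGraph V) (v : V) :
    (Finset.univ.filter fun x => x ≠ v ∧ decide (H.Adj v x) ≠ false).card = H.degree v := by
  rw [← SimpleGraph.card_neighborFinset_eq_degree]
  congr 1
  ext x
  simp only [Finset.mem_filter, Finset.mem_univ, true_and, SimpleGraph.mem_neighborFinset]
  exact ⟨fun h => by simpa using h.2, fun h => ⟨h.ne', by simpa using h⟩⟩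

open Classical in
theorem card_filter_not_adj (H : SimpleGraph V) (v : V) :
    (Finset.univ.filter fun x => x ≠ v ∧ decide (H.Adj v x) ≠ true).card =
      Fintype.card V - 1 - H.degree v := by
  rw [← SimpleGraph.degree_compl, ← SimpleGraph.card_neighborFinset_eq_degree]
  congr 1
  ext x
  simp only [Finset.mem_filter, Finset.mem_univ, true_and, SimpleGraph.mem_neighborFinset,
    SimpleGraph.compl_adj]
  exact ⟨fun h => ⟨h.1.symm, by simpa using h.2⟩, fun h => ⟨h.1.symm, by simpa using h.2⟩⟩

open Classical in
theorem mem_aboveMinDegree {H : SimpleGraph V} {v : V} :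
    v ∈ aboveMinDegree H ↔ H.minDegree < H.degree v := by
  simp [aboveMinDegree]

open Classical in
theorem mem_belowMaxDegree {H : SimpleGraph V} {v : V} :
    v ∈ belowMaxDegree H ↔ H.degree v < H.maxDegree := by
  simp [belowMaxDegree]

/-- Deviations from `false` count neighbours and deviations from `true` count non-neighbours, so
deleted vertices of minimum or maximum degree have the fewest of them. Each call puts its deleted
vertices on top of the levels of the recursive call. -/
theorem exists_isPeeling_deletionChurn (H : SimpleGraph V) :
    ∃ lev bit, IsPeeling H lev bit ∧ ∀ u, lev u = 0 ↔ u ∈ deletionChurn H := by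
  classical
  induction V, ‹Fintype V›, H using deletionChurn.induct with
  | case1 V _ H h =>
    refine ⟨fun _ => 0, fun _ => false, fun u w h => absurd h (lt_irrefl _), fun u => ?_⟩
    rw [deletionChurn, dif_pos h]
    simp
  | case2 V _ H h h₂ ih =>
    obtain ⟨lev, bit, hp, hz⟩ := ih
    obtain ⟨lev', bit', hp', hz'⟩ := hp.extend (H := H) (aboveMinDegree H) false fun u hu w hw => by
      rw [card_filter_adj, card_filter_adj]
      rw [mem_aboveMinDegree] at hu hw
      omega
    refine ⟨lev', bit', hp', fun u => ?_⟩
    rw [hz', deletionChurn, dif_neg h, dif_pos h₂]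
    simp only [hz, Finset.mem_map, Function.Embedding.subtype_apply]
    exact ⟨fun ⟨hu, h⟩ => ⟨⟨u, hu⟩, h, rfl⟩, fun ⟨⟨_, hx⟩, h, he⟩ => he ▸ ⟨hx, h⟩⟩
  | case3 V _ H h h₂ ih =>
    obtain ⟨lev, bit, hp, hz⟩ := ih
    obtain ⟨lev', bit', hp', hz'⟩ := hp.extend (H := H) (belowMaxDegree H) true fun u hu w hw => by
      rw [card_filter_not_adj, card_filter_not_adj]
      rw [mem_belowMaxDegree] at hu hw
      -- This keeps the truncated subtraction for the complement degree strictly decreasing.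
      have := H.degree_lt_card_verts w
      omega
    refine ⟨lev', bit', hp', fun u => ?_⟩
    rw [hz', deletionChurn, dif_neg h, dif_neg h₂]
    simp only [hz, Finset.mem_map, Function.Embedding.subtype_apply]
    exact ⟨fun ⟨hu, h⟩ => ⟨⟨u, hu⟩, h, rfl⟩, fun ⟨⟨_, hx⟩, h, he⟩ => he ▸ ⟨hx, h⟩⟩

end Peeling

/-! ### The structure of the result of Deletion-Churn -/

section Structure

variable {V W : Type u} [Fintype V] [Fintype W]

theorem numEdges_induce_le_one {G : SimpleGraph V} {S : Finset V} :
    numEdges (G.induce (S : Set V)) ≤ 1 ↔ ∀ a ∈ S, ∀ b ∈ S, ∀ c ∈ S, ∀ d ∈ S,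
      G.Adj a b → G.Adj c d → s(a, b) = s(c, d) := by
  rw [numEdges, Set.ncard_le_one_iff]
  constructor
  · intro h a ha b hb c hc d hd hab hcd
    have := @h s(⟨a, ha⟩, ⟨b, hb⟩) s(⟨c, hc⟩, ⟨d, hd⟩) hab hcd
    exact congrArg (Sym2.map Subtype.val) this
  · intro h e f
    induction e with
    | _ a b =>
      induction f with
      | _ c d =>
        intro hab hcd
        exact Sym2.map.injective Subtype.val_injective
          (h a a.2 b b.2 c c.2 d d.2 hab hcd)

theorem numEdges_congr {G : SimpleGraph V} {G' : SimpleGraph W} (e : G ≃g G') :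
    numEdges G = numEdges G' := by
  rw [numEdges, numEdges, ← Nat.card_coe_set_eq, ← Nat.card_coe_set_eq]
  exact Nat.card_congr e.mapEdgeSet

open Classical in
theorem mem_verticesOfDegree {G : SimpleGraph V} {d : ℕ} {v : V} :
    v ∈ verticesOfDegree G d ↔ G.degree v = d := by
  simp [verticesOfDegree]

theorem mem_verticesOfDegree_iso {G : SimpleGraph V} {G' : SimpleGraph W} (e : G ≃g G') {d : ℕ}
    {v : V} : e v ∈ verticesOfDegree G' d ↔ v ∈ verticesOfDegree G d := by
  classical
  rw [mem_verticesOfDegree, mem_verticesOfDegree, ← e.degree_eq]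

theorem IsSparseDegreeGraph.iso {G : SimpleGraph V} {G' : SimpleGraph W} {l h : ℕ}
    (hG : IsSparseDegreeGraph G l h) (e : G' ≃g G) : IsSparseDegreeGraph G' l h := by
  obtain ⟨hlh, hv, h₁, h₂⟩ := hG
  have key : ∀ d, numEdges (G.induce (verticesOfDegree G d : Set V)) ≤ 1 →
      numEdges (G'.induce (verticesOfDegree G' d : Set W)) ≤ 1 := by
    intro d hd
    rw [numEdges_induce_le_one] at hd ⊢
    intro a ha b hb c hc d hd' hab hcd
    rw [← mem_verticesOfDegree_iso e] at ha hb hc hd'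
    exact Sym2.map.injective e.injective
      (hd _ ha _ hb _ hc _ hd' (e.map_adj_iff.2 hab) (e.map_adj_iff.2 hcd))
  refine ⟨hlh, fun v => ?_, key l h₁, key h h₂⟩
  rw [← mem_verticesOfDegree_iso e, ← mem_verticesOfDegree_iso e]
  exact hv (e v)

theorem IsRegularGraph.iso {G : SimpleGraph V} {G' : SimpleGraph W} (hG : IsRegularGraph G)
    (e : G' ≃g G) : IsRegularGraph G' := by
  classical
  obtain ⟨d, hd⟩ := hG
  refine ⟨d, fun v => ?_⟩
  rw [← mem_verticesOfDegree, ← mem_verticesOfDegree_iso e, mem_verticesOfDegree]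
  exact hd (e v)

/-- A graph with at least two edges that is regular, a forest, or a sparse degree graph. -/
def IsChurned (G : SimpleGraph V) : Prop :=
  2 ≤ numEdges G ∧ (IsRegularGraph G ∨ G.IsAcyclic ∨ ∃ l h : ℕ, IsSparseDegreeGraph G l h)

theorem IsChurned.iso {G : SimpleGraph V} {G' : SimpleGraph W} (hG : IsChurned G) (e : G' ≃g G) :
    IsChurned G' := by
  refine ⟨(numEdges_congr e).symm ▸ hG.1, ?_⟩
  rcases hG.2 with h | h | ⟨l, h, hlh⟩
  · exact Or.inl (h.iso e)
  · exact Or.inr (Or.inl (e.isAcyclic_iff.2 h))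
  · exact Or.inr (Or.inr ⟨l, h, hlh.iso e⟩)

-- A vertex on a cycle has degree at least 2, hence above the minimum. The whole cycle, with at
-- least three edges, would lie in a set spanning at most one edge.
open Classical in
theorem isAcyclic_of_minDegree_le_one {G : SimpleGraph V} (hδ : G.minDegree ≤ 1)
    (h : numEdges (G.induce (aboveMinDegree G : Set V)) ≤ 1) : G.IsAcyclic := by
  rw [numEdges_induce_le_one] at h
  intro v c hc
  have hmem : ∀ u ∈ c.support, u ∈ aboveMinDegree G := by
    intro u hu
    rw [mem_aboveMinDegree]
    have h₂ := hc.ncard_neighborSet_toSubgraph_eq_two hu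
    have h₃ := Set.ncard_le_ncard (c.toSubgraph.neighborSet_subset u) (Set.toFinite _)
    rw [h₂, Set.ncard_eq_toFinset_card', ← SimpleGraph.neighborFinset,
      SimpleGraph.card_neighborFinset_eq_degree] at h₃
    omega
  have hall : ∀ e ∈ c.edges, ∀ f ∈ c.edges, e = f := by
    intro e he f hf
    induction e with
    | _ a b =>
      induction f with
      | _ x y =>
        exact h a (hmem a (c.fst_mem_support_of_mem_edges he)) b
          (hmem b (c.snd_mem_support_of_mem_edges he)) x
          (hmem x (c.fst_mem_support_of_mem_edges hf)) y
          (hmem y (c.snd_mem_support_of_mem_edges hf))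
          (c.adj_of_mem_edges he) (c.adj_of_mem_edges hf)
  have hlen := hc.three_le_length
  rw [← SimpleGraph.Walk.length_edges] at hlen
  have hnd := hc.isTrail.edges_nodup
  have h01 := hall c.edges[0] (List.getElem_mem _) c.edges[1] (List.getElem_mem _)
  exact absurd ((hnd.getElem_inj_iff).1 h01) (by norm_num)

theorem isChurned_of_numEdges_le_one {G : SimpleGraph V} (hG : 2 ≤ numEdges G)
    (h₁ : numEdges (G.induce (aboveMinDegree G : Set V)) ≤ 1)
    (h₂ : numEdges (G.induce (belowMaxDegree G : Set V)) ≤ 1) : IsChurned G := by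
  classical
  refine ⟨hG, ?_⟩
  by_cases hδ : G.minDegree ≤ 1
  · exact Or.inr (Or.inl (isAcyclic_of_minDegree_le_one hδ h₁))
  by_cases hreg : ∀ v, G.degree v = G.minDegree
  · exact Or.inl ⟨_, hreg⟩
  push Not at hreg hδ
  obtain ⟨v₀, hv₀⟩ := hreg
  have hlt : G.minDegree < G.maxDegree :=
    (lt_of_le_of_ne (G.minDegree_le_degree v₀) hv₀.symm).trans_le (G.degree_le_maxDegree v₀)
  have hA := numEdges_induce_le_one.1 h₁
  have hB := numEdges_induce_le_one.1 h₂
  refine Or.inr (Or.inr ⟨G.minDegree, G.maxDegree, hlt, fun m => ?_, ?_, ?_⟩)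
  · rw [mem_verticesOfDegree, mem_verticesOfDegree]
    by_contra! hm
    have hmA : m ∈ aboveMinDegree G :=
      mem_aboveMinDegree.2 (lt_of_le_of_ne (G.minDegree_le_degree m) hm.1.symm)
    have hmB : m ∈ belowMaxDegree G :=
      mem_belowMaxDegree.2 (lt_of_le_of_ne (G.degree_le_maxDegree m) hm.2)
    -- No degree can be equal to both extremes, as these differ.
    have hcase : ∀ x, x ∈ aboveMinDegree G ∨ x ∈ belowMaxDegree G := by
      intro x
      rw [mem_aboveMinDegree, mem_belowMaxDegree]
      omega
    have eqA : ∀ x y, G.Adj m x → G.Adj m y → x ∈ aboveMinDegree G → y ∈ aboveMinDegree G →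
        x = y := fun x y hx hy hxA hyA => Sym2.congr_right.1 (hA m hmA x hxA m hmA y hyA hx hy)
    have eqB : ∀ x y, G.Adj m x → G.Adj m y → x ∈ belowMaxDegree G → y ∈ belowMaxDegree G →
        x = y := fun x y hx hy hxB hyB => Sym2.congr_right.1 (hB m hmB x hxB m hmB y hyB hx hy)
    have hdeg : 2 < (G.neighborFinset m).card := by
      rw [SimpleGraph.card_neighborFinset_eq_degree]
      have := mem_aboveMinDegree.1 hmA
      omega
    obtain ⟨x, y, z, hx, hy, hz, hxy, hxz, hyz⟩ := Finset.two_lt_card_iff.1 hdeg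
    rw [SimpleGraph.mem_neighborFinset] at hx hy hz
    -- Among three neighbours of `m` two share a class; since `m` lies in both classes, that class
    -- would span two edges at `m`.
    rcases hcase x with hx' | hx' <;> rcases hcase y with hy' | hy' <;>
      rcases hcase z with hz' | hz'
    all_goals first
      | exact hxy (eqA x y hx hy hx' hy')
      | exact hxy (eqB x y hx hy hx' hy')
      | exact hxz (eqA x z hx hz hx' hz')
      | exact hxz (eqB x z hx hz hx' hz')
      | exact hyz (eqA y z hy hz hy' hz')
      | exact hyz (eqB y z hy hz hy' hz')
  · have hsub : ∀ x ∈ verticesOfDegree G G.minDegree, x ∈ belowMaxDegree G := by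
      intro x hx
      rw [mem_verticesOfDegree] at hx
      rw [mem_belowMaxDegree]
      omega
    exact numEdges_induce_le_one.2 fun a ha b hb c hc d hd =>
      hB a (hsub a ha) b (hsub b hb) c (hsub c hc) d (hsub d hd)
  · have hsub : ∀ x ∈ verticesOfDegree G G.maxDegree, x ∈ aboveMinDegree G := by
      intro x hx
      rw [mem_verticesOfDegree] at hx
      rw [mem_aboveMinDegree]
      omega
    exact numEdges_induce_le_one.2 fun a ha b hb c hc d hd =>
      hA a (hsub a ha) b (hsub b hb) c (hsub c hc) d (hsub d hd)

/-- An induced subgraph of an induced subgraph is an induced subgraph. -/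
def induceMapIso (H : SimpleGraph V) (S : Set V) (T : Finset S) :
    H.induce ((T.map (Function.Embedding.subtype _) : Finset V) : Set V) ≃g
      (H.induce S).induce (T : Set S) where
  toFun x := ⟨⟨x.1, by
    obtain ⟨y, _, hy⟩ := Finset.mem_map.1 (Finset.mem_coe.1 x.2)
    exact hy ▸ y.2⟩, by
    obtain ⟨y, hyT, hy⟩ := Finset.mem_map.1 (Finset.mem_coe.1 x.2)
    simpa [← hy] using hyT⟩
  invFun x := ⟨x.1.1, Finset.mem_coe.2 (Finset.mem_map.2 ⟨x.1, x.2, rfl⟩)⟩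
  left_inv _ := rfl
  right_inv _ := rfl
  map_rel_iff' := Iff.rfl

theorem isChurned_deletionChurn (H : SimpleGraph V) (hH : 2 ≤ numEdges H) :
    IsChurned (H.induce (deletionChurn H : Set V)) := by
  classical
  induction V, ‹Fintype V›, H using deletionChurn.induct with
  | case1 V _ H h =>
    rw [deletionChurn, dif_pos h]
    have e : H.induce ((Finset.univ : Finset V) : Set V) ≃g H :=
      ⟨⟨Subtype.val, fun x => ⟨x, by simp⟩, fun _ => rfl, fun _ => rfl⟩, Iff.rfl⟩
    exact (isChurned_of_numEdges_le_one hH h.1 h.2).iso e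
  | case2 V _ H h h₂ ih =>
    rw [deletionChurn, dif_neg h, dif_pos h₂]
    exact (ih h₂).iso (induceMapIso ..)
  | case3 V _ H h h₂ ih =>
    rw [deletionChurn, dif_neg h, dif_neg h₂]
    exact (ih (by omega)).iso (induceMapIso ..)

end Structure

/-! ### Assembly of the structural statement and the reduction. -/

theorem mainTheorem8 {V : Type u} [Fintype V] (H : SimpleGraph V) (hH : 2 ≤ numEdges H) :
    2 ≤ numEdges (H.induce (deletionChurn H : Set V)) ∧
    (IsRegularGraph (H.induce (deletionChurn H : Set V)) ∨
      (H.induce (deletionChurn H : Set V)).IsAcyclic ∨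
      ∃ l h : ℕ, IsSparseDegreeGraph (H.induce (deletionChurn H : Set V)) l h) ∧
    LinearParamReducible (freeEdgeDeletion (H.induce (deletionChurn H : Set V)))
      (freeEdgeDeletion H) := by
  have hc := isChurned_deletionChurn H hH
  refine ⟨hc.1, hc.2, ?_⟩
  obtain ⟨lev, bit, hp, hz⟩ := exists_isPeeling_deletionChurn H
  have hset : (deletionChurn H : Set V) = {u | lev u = 0} := by
    ext u
    simp [hz]
  -- The reduction needs a vertex of level 0, and the returned graph has one because it has edges.
  obtain ⟨u⟩ := nonempty_of_numEdges (S := Finset.univ)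
    (G := H.induce (deletionChurn H : Set V)) (by
      refine hc.1.trans_eq (numEdges_congr ?_)
      exact ⟨⟨fun x => ⟨x, by simp⟩, Subtype.val, fun _ => rfl, fun _ => rfl⟩, Iff.rfl⟩)
  have h := hp.linearParamReducible ⟨u, (hz u).2 u.2⟩
  rwa [← hset] at h
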